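/- **Theorem (scale-invariant fast convergence to correlated equilibrium).** There is an absolute constant $C>0$ such that the following holds. Consider a game with $n\ge 2$ players in which player $i\in[n]$ has a finite action set $\mathcal A_i$ of size $m_i$ and a utility function $u_i:\mathcal A_1\times\cdots\times\mathcal A_n\to[-U_{\max},U_{\max}]$; let $m=\max_i m_i$, and let $T\ge 2$ be the number of rounds. In round $t=1,\dots,T$ each player $i$ plays a mixed strategy $x_i^t\in\Delta_{m_i}$ and observes the vector $u_i^t$ with entries $u_i^t(a)=\mathbb E_{a_{-i}\sim x_{-i}^t}[u_i(a,a_{-i})]$; put $u_i^0=\mathbf 0$. Suppose that every player runs the following algorithm. * *Clipping.* $B^1=\max_i\|u_i^1\|_\infty$ and $B^{t+1}=\min\{2^kB^t: k\in\{0,1,2,\dots\},\ 2^{k+1}B^t\ge\max_i\|u_i^t\|_\infty\}$; for each action $a\in\mathcal A_i$ let $\bar u_{i,a}^t=\frac{B^t}{B^{t+1}}x_i^t(a)\,u_i^t$ and $\bar u_i^t=\frac{B^t}{B^{t+1}}u_i^t$, and $\bar u_{i,a}^0=\bar u_i^0=\mathbf 0$ (if $B^1=0$, these are $\mathbf 0$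 and $B^t=0$ for all $t$). * *Learning rate.* With $U^t=\max_{1\le s\le t}\max_i\|u_i^s\|_\infty$, $U^0=0$, and $P_\infty^t(z)=\sum_{s=1}^{t-1}\|z^s-z^{s-1}\|_\infty^2$, $$\eta_i^t=\min\left\{\frac{m_i\sqrt{\log T}}{\sqrt{8n\,(U^{t-1})^2+\sum_{j\in[n]}P_\infty^t(v_j)}},\ \frac{1}{256\sqrt{m_i}\,B^t}\right\},$$ where either $v_j=\bar u_j$ for all $j$, or $v_j=u_j$ for all $j$ (the theorem holds for both versions of the algorithm). * *Experts.* For each $a\in\mathcal A_i$, $$y_{i,a}^t=\operatorname*{argmax}_{y\in\Delta_{m_i}}\Big\{\Big\langle y,\ \bar u_{i,a}^{t-1}+\sum_{s=1}^{t-1}\bar u_{i,a}^s\Big\rangle-\frac{\phi(y)}{\eta_i^t}\Big\},\qquad \phi(y)=-\sum_k\log y(k),$$ and $y_{i,a}^t=\frac1{m_i}\mathbf 1$ if one of the two denominators in $\eta_i^t$ is zero. * *Strategy.* $x_i^t\in\Delta_{m_i}$ is a stationary distribution of the Markov chain whose transition matrix $Q_i^t$ has rows $Q_i^t(a,\cdot)=y_{i,a}^t$,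 that is, $(Q_i^t)^\top x_i^t=x_i^t$. Then, for every player $i$, the swap regret $$\mathsf{SwapReg}_{x_i}^T=\max_{M}\sum_{t=1}^T\langle x_i^t,\ Mu_i^t-u_i^t\rangle ,$$ the maximum being over all row-stochastic $m_i\times m_i$ matrices $M$, satisfies $$\mathsf{SwapReg}_{x_i}^T\le C\,U_{\max}\,n^{3/2}m^{5/2}\log T ,$$ with no dependence on the initial gradient scale $\max_i\|u_i^1\|_\infty$. Consequently the time-averaged joint play $\sigma=\frac1T\sum_{t=1}^T\bigotimes_{i}x_i^t$ is an $\varepsilon$-approximate correlated equilibrium with $\varepsilon=C\,U_{\max}\,n^{3/2}m^{5/2}\log T/T$: for every player $i$ and every $\varphi:\mathcal A_i\to\mathcal A_i$, $$\mathbb E_{a\sim\sigma}[u_i(a)]\ \ge\ \mathbb E_{a\sim\sigma}[u_i(\varphi(a_i),a_{-i})]-\varepsilon .$$ -/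

import Mathlib

open scoped BigOperators Matrix

noncomputable section

namespace SwapDynamics

/-! Throughout, the players are the elements of `Fin n`, the finite action set of player `i` is `A i`,
the utility functions are `u : Fin n → (∀ j, A j) → ℝ`, and `x t i : A i → ℝ` is the mixed strategy
of player `i` in round `t ≥ 1`.  The norm of a real vector `A i → ℝ` is the sup-norm, and the norm
of a family `g : ∀ i, A i → ℝ` of such vectors is the maximum over `i` of the sup-norms. -/

/-- The expected utility vectors: entry `a` of the vector of player `i` is the expectation of
`u i (a, b₋ᵢ)` when the opponents draw `b₋ᵢ` from the product of their mixed strategies `p j`,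
`j ≠ i`.  The partial profiles `b₋ᵢ` are represented by the profiles `b` with `b i = a`. -/
def expectedUtility {n : ℕ} {A : Fin n → Type*} [∀ i, Fintype (A i)] [∀ i, DecidableEq (A i)]
    (u : Fin n → (∀ j, A j) → ℝ) (p : ∀ j, A j → ℝ) : ∀ i, A i → ℝ :=
  fun i a => ∑ b : (∀ j, A j) with b i = a, (∏ j ∈ Finset.univ.erase i, p j (b j)) * u i b

/-- The gradients `u_i^t` observed in round `t ≥ 1`, with the convention `u_i^0 = 0`. -/
def gradient {n : ℕ} {A : Fin n → Type*} [∀ i, Fintype (A i)] [∀ i, DecidableEq (A i)]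
    (u : Fin n → (∀ j, A j) → ℝ) (x : ℕ → ∀ j, A j → ℝ) : ℕ → ∀ i, A i → ℝ :=
  fun t => if t = 0 then 0 else expectedUtility u (x t)

/-- `U^t = max_{1 ≤ s ≤ t} max_i ‖g_i^s‖_∞`, with `U^0 = 0`. -/
def runningMax {n : ℕ} {A : Fin n → Type*} [∀ i, Fintype (A i)]
    (g : ℕ → ∀ i, A i → ℝ) : ℕ → ℝ
  | 0 => 0
  | t + 1 => max (runningMax g t) ‖g (t + 1)‖

/-- `min {2^k B : k ∈ ℕ, 2^(k+1) B ≥ M}` for `B > 0` (the minimum is attained at the least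
admissible `k`); the value is `0` for `B = 0`. -/
def nextScale (B M : ℝ) : ℝ := 2 ^ sInf {k : ℕ | M ≤ 2 ^ (k + 1) * B} * B

/-- The clipping scales `B^t`, `t ≥ 1`: `B^1 = max_i ‖g_i^1‖_∞` and
`B^(t+1) = min {2^k B^t : k ∈ ℕ, 2^(k+1) B^t ≥ max_i ‖g_i^t‖_∞}` (for `t = 1` this gives
`B^2 = B^1`).  The value at `t = 0` is irrelevant. -/
def clipScale {n : ℕ} {A : Fin n → Type*} [∀ i, Fintype (A i)]
    (g : ℕ → ∀ i, A i → ℝ) : ℕ → ℝ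
  | 0 => ‖g 1‖
  | 1 => ‖g 1‖
  | t + 2 => nextScale (clipScale g (t + 1)) ‖g (t + 1)‖

/-- The clipped gradients `(B^t / B^(t+1)) g_i^t`. -/
def clippedGradient {n : ℕ} {A : Fin n → Type*} [∀ i, Fintype (A i)]
    (g : ℕ → ∀ i, A i → ℝ) : ℕ → ∀ i, A i → ℝ :=
  fun t i => (clipScale g t / clipScale g (t + 1)) • g t i

/-- The clipped gradient `(B^t / B^(t+1)) x_i^t(a) g_i^t` that is fed to expert `a` of player
`i`. -/
def clippedExpertGradient {n : ℕ} {A : Fin n → Type*} [∀ i, Fintype (A i)]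
    (g x : ℕ → ∀ i, A i → ℝ) (i : Fin n) (a : A i) : ℕ → A i → ℝ :=
  fun t => (clipScale g t / clipScale g (t + 1)) • (x t i a • g t i)

/-- The squared path length `∑_{s=1}^{t-1} ‖z^s - z^(s-1)‖²` up to round `t - 1`, for `t ≥ 1`. -/
def pathLength {E : Type*} [NormedAddCommGroup E] (z : ℕ → E) (t : ℕ) : ℝ :=
  ∑ s ∈ Finset.range (t - 1), ‖z (s + 1) - z s‖ ^ 2

/-- `√(8 n (U^(t-1))² + ∑_j P_∞^t(v_j))`, where `U` is the running maximum of the gradients `g` and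
the path lengths are those of the vector sequences `v`. -/
def rateDenominator {n : ℕ} {A : Fin n → Type*} [∀ i, Fintype (A i)]
    (g v : ℕ → ∀ i, A i → ℝ) (t : ℕ) : ℝ :=
  √(8 * n * runningMax g (t - 1) ^ 2 + ∑ j, pathLength (fun s => v s j) t)

/-- The learning rate of player `i` in round `t`, for the time horizon `T`:
`min {mᵢ √(log T) / rateDenominator, (1 / (256 √mᵢ)) / B^t}` with `mᵢ` the number of actions of
player `i`. It is used only when both denominators are nonzero. -/
def learningRate {n : ℕ} {A : Fin n → Type*} [∀ i, Fintype (A i)]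
    (T : ℕ) (g v : ℕ → ∀ i, A i → ℝ) (i : Fin n) (t : ℕ) : ℝ :=
  min (Fintype.card (A i) * √(Real.log T) / rateDenominator g v t)
    (1 / (256 * √(Fintype.card (A i) : ℝ)) / clipScale g t)

/-- The logarithmic barrier, on vectors with positive entries. -/
def logBarrier {α : Type*} [Fintype α] (y : α → ℝ) : ℝ := -∑ k, Real.log (y k)

/-- `y` maximizes `⟨y, L⟩ - φ(y) / η` over the probability simplex, where `φ` is the logarithmic
barrier. As `φ = +∞` on the relative boundary of the simplex, the maximum is over the probability
vectors with positive entries. -/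
def IsBarrierMaximizer {α : Type*} [Fintype α] (L : α → ℝ) (η : ℝ) (y : α → ℝ) : Prop :=
  (y ∈ stdSimplex ℝ α ∧ ∀ k, 0 < y k) ∧
    IsMaxOn (fun z => z ⬝ᵥ L - logBarrier z / η) {z | z ∈ stdSimplex ℝ α ∧ ∀ k, 0 < z k} y

/-- All players run the no-swap-regret algorithm for `T` rounds in the game with utilities `u`:
`y t i a` is the output of expert `a` of player `i` in round `t`, `x t i` is the strategy played,
and `v` is the family of vector sequences whose path lengths enter the learning rates. -/
structure IsRun {n : ℕ} {A : Fin n → Type*} [∀ i, Fintype (A i)] [∀ i, DecidableEq (A i)]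
    (u : Fin n → (∀ j, A j) → ℝ) (T : ℕ) (v : ℕ → ∀ i, A i → ℝ)
    (x : ℕ → ∀ i, A i → ℝ) (y : ℕ → ∀ i, A i → A i → ℝ) : Prop where
  /-- If a denominator in the learning rate vanishes, then the experts output the uniform
  distribution. -/
  expert_uniform : ∀ t ∈ Finset.Icc 1 T, ∀ i a,
    (rateDenominator (gradient u x) v t = 0 ∨ clipScale (gradient u x) t = 0) →
      y t i a = fun _ => 1 / (Fintype.card (A i) : ℝ)
  /-- Otherwise the experts use optimistic FTRL with the logarithmic barrier on the clipped
  gradients, the prediction being the last clipped gradient. -/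
  expert_oftrl : ∀ t ∈ Finset.Icc 1 T, ∀ i a,
    rateDenominator (gradient u x) v t ≠ 0 → clipScale (gradient u x) t ≠ 0 →
      IsBarrierMaximizer
        (clippedExpertGradient (gradient u x) x i a (t - 1) +
          ∑ s ∈ Finset.Icc 1 (t - 1), clippedExpertGradient (gradient u x) x i a s)
        (learningRate T (gradient u x) v i t) (y t i a)
  /-- The strategies are probability vectors. -/
  strategy_mem : ∀ t ∈ Finset.Icc 1 T, ∀ i, x t i ∈ stdSimplex ℝ (A i)
  /-- The strategy is stationary for the Markov chain whose rows are the experts' outputs. -/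
  strategy_stationary : ∀ t ∈ Finset.Icc 1 T, ∀ i, (Matrix.of (y t i))ᵀ *ᵥ x t i = x t i

/-- The swap regret of the strategies `x` for the gradients `g` after `T` rounds, against the
matrix `M`. -/
def swapRegretAgainst {α : Type*} [Fintype α] (x g : ℕ → α → ℝ) (T : ℕ) (M : Matrix α α ℝ) : ℝ :=
  ∑ t ∈ Finset.Icc 1 T, x t ⬝ᵥ (M *ᵥ g t - g t)

/-- The swap regret: the maximum of `swapRegretAgainst` over all row-stochastic matrices. -/
def swapRegret {α : Type*} [Fintype α] [DecidableEq α] (x g : ℕ → α → ℝ) (T : ℕ) : ℝ :=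
  sSup (swapRegretAgainst x g T '' {M | M ∈ Matrix.rowStochastic ℝ α})

/-- The supremum in the definition of the swap regret is a maximum. -/
theorem swapRegret_isGreatest {α : Type*} [Fintype α] [DecidableEq α] (x g : ℕ → α → ℝ) (T : ℕ) :
    IsGreatest (swapRegretAgainst x g T '' {M | M ∈ Matrix.rowStochastic ℝ α})
      (swapRegret x g T) := by
  have hset : {M : Matrix α α ℝ | M ∈ Matrix.rowStochastic ℝ α} =
      Set.univ.pi (fun _ : α => stdSimplex ℝ α) := by
    ext M
    have h1 : M ∈ {M : Matrix α α ℝ | M ∈ Matrix.rowStochastic ℝ α} ↔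
        (∀ i j, 0 ≤ M i j) ∧ ∀ i, ∑ j, M i j = 1 := Matrix.mem_rowStochastic_iff_sum
    rw [h1]
    exact ⟨fun h i _ => ⟨h.1 i, h.2 i⟩,
      fun h => ⟨fun i => (h i trivial).1, fun i => (h i trivial).2⟩⟩
  have hcomp : IsCompact {M : Matrix α α ℝ | M ∈ Matrix.rowStochastic ℝ α} := by
    rw [hset]
    exact isCompact_univ_pi fun _ => isCompact_stdSimplex ℝ α
  have hcont : Continuous (swapRegretAgainst x g T) := by
    unfold swapRegretAgainst
    fun_prop
  exact (hcomp.image hcont).isGreatest_sSup (Set.Nonempty.image _ ⟨1, one_mem (Matrix.rowStochastic ℝ α)⟩)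

/-- `σ` is an `ε`-approximate correlated equilibrium of the game with utilities `u`. -/
def IsApproxCorrelatedEquilibrium {n : ℕ} {A : Fin n → Type*} [∀ i, Fintype (A i)]
    [∀ i, DecidableEq (A i)] (u : Fin n → (∀ j, A j) → ℝ) (ε : ℝ) (σ : (∀ j, A j) → ℝ) : Prop :=
  σ ∈ stdSimplex ℝ (∀ j, A j) ∧
    ∀ (i : Fin n) (φ : A i → A i),
      ∑ b, σ b * u i b ≥ ∑ b, σ b * u i (Function.update b i (φ (b i))) - ε

/-- The time average of the product distributions `⊗_i x_i^t` over the rounds `1, …, T`. -/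
def averagePlay {n : ℕ} {A : Fin n → Type*} (x : ℕ → ∀ i, A i → ℝ) (T : ℕ) :
    (∀ j, A j) → ℝ :=
  fun b => (1 / (T : ℝ)) * ∑ t ∈ Finset.Icc 1 T, ∏ i, x t i (b i)

/-- The largest number of actions of a player. -/
def maxActions {n : ℕ} (A : Fin n → Type*) [∀ i, Fintype (A i)] : ℕ :=
  Finset.univ.sup fun i => Fintype.card (A i)

end SwapDynamics

end

noncomputable section

namespace SwapDynamics

/-! ### Scalar inequalities for the logarithm -/

/-! Stationarity of `x` turns the swap regret of a player into the sum over actions `a` of the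
ordinary regret of expert `a`, fed with `x(a)` times the gradient (`IsStationary.dotProduct_swap`).
Each expert is optimistic FTRL with the logarithmic barrier. Its regret is at most a barrier term,
plus `η` times the squared movement of its gradients, minus Bregman divergences between consecutive
outputs (`oftrl_regret_bound`). These divergences measure relative changes of the rows of the
transition matrix. Relative changes of the rows control the `ℓ¹` movement of the stationary
distribution without any mixing assumption (`IsStationary.l1_dist_le`). Hence, up to constants, the
regret is at most `m² log T / η + ∑ η ‖Δu‖² - ∑ ‖Δx‖₁² / (m η)` (`experts_regret_bound`).

The gradient scale drops out for two reasons. The clipping errors telescope to a multiple of the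
last scale. A scale that moves at least doubles, so the rounds near a change of scale contribute a
geometric sum, of order `U` (`sum_clipScale_not_steady_le`). In the remaining, steady, rounds
nothing is clipped, and both versions of the learning rate see the same increments
(`IsRateSequence.sub_eq`).

Let `W²` be the squared path length of the gradients over the steady rounds. The learning rate gives
a regret of at most `Z - c ∑ ρ ‖Δx‖₁²`, where `ρ` is the denominator of the rate and `Z` is affine
in `W`. The regret against the identity matrix is `0`, so the weighted movement of every player is
bounded by a multiple of `Z`. Gradients move only if strategies move, and `ρ` dominates the square
root of the path length, so `W³` is at most a multiple of the total weighted movement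
(`IsRun.sqrt_sum_pow_three_le`). A cube bounded by an affine function of `W` forces `W` to be of
order `U n^(3/2) m^(3/2) √(log T)`. Substituting this into `Z` gives the bound (`self_bounding`). If
the first gradients vanish, all play stays uniform and there is no regret. -/

theorem mul_sub_one_le_sub_log {r v : ℝ} (hr : 0 < r) (hv : |v| ≤ 1 / 2) :
    v * (r - 1) ≤ (r - 1 - Real.log r) + 2 * v ^ 2 := by
  obtain ⟨h1, h2⟩ := abs_le.1 hv
  have hpos : 0 < 1 - v := by linarith
  -- This is a Fenchel–Young inequality for `r - 1 - log r`. The supremum over `r` is attained at `r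
  -- = 1 / (1 - v)`, hence the tangent of the logarithm is taken at `r (1 - v) = 1`.
  have hlog := Real.log_le_sub_one_of_pos (mul_pos hr hpos)
  rw [Real.log_mul hr.ne' hpos.ne'] at hlog
  have hlog' := Real.one_sub_inv_le_log_of_pos hpos
  have : (1 - v)⁻¹ ≤ 1 + v + 2 * v ^ 2 := by
    rw [inv_le_iff_one_le_mul₀ hpos]
    nlinarith [sq_nonneg v, mul_nonneg (sq_nonneg v) (by linarith : (0:ℝ) ≤ 1 - 2 * v)]
  nlinarith

/-- Applying `log s ≤ s - 1` to `s = √r` gives `(√r - 1)² ≤ r - 1 - log r`. For `√r ≤ 2` the factor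
`(√r + 1)² ≤ 9` converts this to `(r - 1)²`; otherwise `√r - 1 > 1` already. The truncation at `1`
is forced because `r - 1 - log r` grows only linearly. -/
theorem sq_min_abs_le_sub_log {r : ℝ} (hr : 0 < r) :
    (min |r - 1| 1) ^ 2 ≤ 9 * (r - 1 - Real.log r) := by
  have hs : 0 < √r := Real.sqrt_pos.2 hr
  have hsq : √r ^ 2 = r := Real.sq_sqrt hr.le
  have hlog : Real.log r ≤ 2 * (√r - 1) := by
    have h := Real.log_le_sub_one_of_pos hs
    rw [Real.log_sqrt hr.le] at h
    linarith
  have key : (√r - 1) ^ 2 ≤ r - 1 - Real.log r := by nlinarith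
  have h0 : 0 ≤ min |r - 1| 1 := le_min (abs_nonneg _) zero_le_one
  rcases le_or_gt (√r) 2 with h | h
  · have h1 : (min |r - 1| 1) ^ 2 ≤ (r - 1) ^ 2 := by
      rw [← sq_abs (r - 1)]
      exact pow_le_pow_left₀ h0 (min_le_left _ _) 2
    have h2 : (r - 1) ^ 2 = (√r - 1) ^ 2 * (√r + 1) ^ 2 := by
      nth_rewrite 1 [← hsq]; ring
    have h3 : (√r + 1) ^ 2 ≤ 9 := by nlinarith
    nlinarith [mul_le_mul_of_nonneg_left h3 (sq_nonneg (√r - 1))]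
  · have h1 : (min |r - 1| 1) ^ 2 ≤ 1 := pow_le_one₀ h0 (min_le_right _ _)
    nlinarith

/-! ### Optimistic follow the regularized leader with the logarithmic barrier -/

/-- The Bregman divergence of the logarithmic barrier. -/
def barrierDivergence {α : Type*} [Fintype α] (z y : α → ℝ) : ℝ :=
  ∑ k, (z k / y k - 1 - Real.log (z k / y k))

section OFTRL

variable {α : Type*} [Fintype α]

theorem barrierDivergence_term_nonneg {r : ℝ} (hr : 0 < r) : 0 ≤ r - 1 - Real.log r := by
  linarith [Real.log_le_sub_one_of_pos hr]

theorem barrierDivergence_nonneg {z y : α → ℝ} (hz : ∀ k, 0 < z k) (hy : ∀ k, 0 < y k) :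
    0 ≤ barrierDivergence z y :=
  Finset.sum_nonneg fun k _ => barrierDivergence_term_nonneg (div_pos (hz k) (hy k))

theorem sq_min_abs_le_barrierDivergence {z y : α → ℝ} (hz : ∀ k, 0 < z k) (hy : ∀ k, 0 < y k)
    (k : α) : (min |z k / y k - 1| 1) ^ 2 ≤ 9 * barrierDivergence z y := by
  refine (sq_min_abs_le_sub_log (div_pos (hz k) (hy k))).trans ?_
  have := Finset.single_le_sum (f := fun k => z k / y k - 1 - Real.log (z k / y k))
    (fun k _ => barrierDivergence_term_nonneg (div_pos (hz k) (hy k))) (Finset.mem_univ k)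
  unfold barrierDivergence
  linarith

/-- First-order optimality of a barrier maximizer. -/
theorem IsBarrierMaximizer.gradient_eq {L y z : α → ℝ} {η : ℝ} (hy : IsBarrierMaximizer L η y)
    (hz : z ∈ stdSimplex ℝ α) :
    (z - y) ⬝ᵥ L + (∑ k, (z k - y k) / y k) / η = 0 := by
  obtain ⟨⟨hymem, hypos⟩, hmax⟩ := hy
  -- The objective on the line from `y` to `z`. Near `s = 0` the points stay positive because `y`
  -- is, so `z` may lie on the boundary of the simplex.
  set F : ℝ → ℝ := fun s => (y + s • (z - y)) ⬝ᵥ L - logBarrier (y + s • (z - y)) / η with hF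
  have hlocal : IsLocalMax F 0 := by
    have hpos : ∀ᶠ s in nhds (0 : ℝ), ∀ k, 0 < (y + s • (z - y)) k := by
      rw [Filter.eventually_all]
      intro k
      have hc : ContinuousAt (fun s : ℝ => (y + s • (z - y)) k) 0 := by
        simp only [Pi.add_apply, Pi.smul_apply, smul_eq_mul]
        fun_prop
      exact hc.eventually (lt_mem_nhds (by simpa using hypos k))
    filter_upwards [hpos] with s hs
    have hmem : (y + s • (z - y)) ∈ {z | z ∈ stdSimplex ℝ α ∧ ∀ k, 0 < z k} := by
      refine ⟨⟨fun k => (hs k).le, ?_⟩, hs⟩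
      simp only [Pi.add_apply, Pi.smul_apply, smul_eq_mul, Pi.sub_apply, Finset.sum_add_distrib,
        ← Finset.mul_sum, Finset.sum_sub_distrib, hymem.2, hz.2]
      ring
    have := hmax hmem
    simpa [hF] using this
  have hderiv : HasDerivAt F ((z - y) ⬝ᵥ L + (∑ k, (z k - y k) / y k) / η) 0 := by
    have h1 : HasDerivAt (fun s : ℝ => (y + s • (z - y)) ⬝ᵥ L) ((z - y) ⬝ᵥ L) 0 := by
      have : (fun s : ℝ => (y + s • (z - y)) ⬝ᵥ L) = fun s => y ⬝ᵥ L + s * ((z - y) ⬝ᵥ L) := by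
        funext s
        rw [add_dotProduct, smul_dotProduct, smul_eq_mul]
      rw [this]
      simpa using ((hasDerivAt_id (0 : ℝ)).mul_const ((z - y) ⬝ᵥ L)).const_add (y ⬝ᵥ L)
    have h2 : HasDerivAt (fun s : ℝ => logBarrier (y + s • (z - y)))
        (-∑ k, (z k - y k) / y k) 0 := by
      unfold logBarrier
      refine HasDerivAt.neg ?_
      refine HasDerivAt.fun_sum fun k _ => ?_
      have h3 : HasDerivAt (fun s : ℝ => (y + s • (z - y)) k) (z k - y k) 0 := by
        simpa using ((hasDerivAt_id (0 : ℝ)).mul_const (z k - y k)).const_add (y k)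
      have := h3.log (by simpa using (hypos k).ne')
      simpa using this
    have := h1.sub (h2.div_const η)
    rwa [neg_div, sub_neg_eq_add] at this
  exact hlocal.hasDerivAt_eq_zero hderiv

theorem logBarrier_eq_add_divergence {z y : α → ℝ} (hz : ∀ k, 0 < z k) (hy : ∀ k, 0 < y k) :
    logBarrier z = logBarrier y - ∑ k, (z k - y k) / y k + barrierDivergence z y := by
  have : ∀ k, z k / y k - 1 - Real.log (z k / y k)
      = (z k - y k) / y k - Real.log (z k) + Real.log (y k) := by
    intro k
    rw [Real.log_div (hz k).ne' (hy k).ne', sub_div, div_self (hy k).ne']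
    ring
  unfold logBarrier barrierDivergence
  simp only [this, Finset.sum_add_distrib, Finset.sum_sub_distrib]
  ring

/-- Strong optimality: the gap to a barrier maximizer is the Bregman divergence. -/
theorem IsBarrierMaximizer.objective_eq {L y z : α → ℝ} {η : ℝ} (hy : IsBarrierMaximizer L η y)
    (hz : z ∈ stdSimplex ℝ α) (hzpos : ∀ k, 0 < z k) :
    logBarrier z / η - z ⬝ᵥ L = logBarrier y / η - y ⬝ᵥ L + barrierDivergence z y / η := by
  have h := hy.gradient_eq hz
  rw [logBarrier_eq_add_divergence hzpos hy.1.2]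
  rw [sub_dotProduct] at h
  have : (logBarrier y - ∑ k, (z k - y k) / y k + barrierDivergence z y) / η
    = logBarrier y / η - (∑ k, (z k - y k) / y k) / η + barrierDivergence z y / η := by ring
  linarith

/-- The uniform distribution minimizes the logarithmic barrier. -/
theorem card_mul_log_le_logBarrier {y : α → ℝ} (hy : y ∈ stdSimplex ℝ α) (hpos : ∀ k, 0 < y k) :
    (Fintype.card α : ℝ) * Real.log (Fintype.card α) ≤ logBarrier y := by
  rcases isEmpty_or_nonempty α with h | h
  · simp [logBarrier]
  have hm : (0 : ℝ) < Fintype.card α := by exact_mod_cast Fintype.card_pos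
  have : ∑ k, (Real.log (y k) + Real.log (Fintype.card α))
      ≤ ∑ k : α, (Fintype.card α * y k - 1) := by
    refine Finset.sum_le_sum fun k _ => ?_
    rw [add_comm, ← Real.log_mul hm.ne' (hpos k).ne']
    exact Real.log_le_sub_one_of_pos (mul_pos hm (hpos k))
  simp only [Finset.sum_add_distrib, Finset.sum_sub_distrib, ← Finset.mul_sum, hy.2,
    Finset.sum_const, Finset.card_univ, nsmul_eq_mul] at this
  unfold logBarrier
  linarith

theorem isBarrierMaximizer_uniform [Nonempty α] {η : ℝ} (hη : 0 < η) :
    IsBarrierMaximizer (0 : α → ℝ) η (fun _ => 1 / (Fintype.card α : ℝ)) := by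
  have hm : (0 : ℝ) < Fintype.card α := by exact_mod_cast Fintype.card_pos
  refine ⟨⟨⟨fun k => by positivity, by simp⟩, fun k => by positivity⟩, ?_⟩
  rintro z ⟨hz, hpos⟩
  have h := card_mul_log_le_logBarrier hz hpos
  have h2 : logBarrier (fun _ : α => 1 / (Fintype.card α : ℝ))
      = Fintype.card α * Real.log (Fintype.card α) := by
    simp [logBarrier]
  simp only [Set.mem_ofPred_eq, dotProduct_zero, zero_sub, h2, neg_le_neg_iff]
  gcongr

/-- The stability term is absorbed by half of the divergence. -/
theorem dotProduct_le_divergence {z y w : α → ℝ} {η : ℝ} (hη : 0 < η) (hz : ∀ k, 0 < z k)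
    (hy : y ∈ stdSimplex ℝ α) (hypos : ∀ k, 0 < y k) (hw : η * ‖w‖ ≤ 1 / 4) :
    (z - y) ⬝ᵥ w ≤ barrierDivergence z y / (2 * η) + 4 * η * ‖w‖ ^ 2 := by
  have hy1 : ∀ k, y k ≤ 1 := fun k => by
    rw [← hy.2]; exact Finset.single_le_sum (fun k _ => hy.1 k) (Finset.mem_univ k)
  have hterm : ∀ k, (z k - y k) * w k ≤
      (z k / y k - 1 - Real.log (z k / y k)) / (2 * η) + 4 * η * ‖w‖ ^ 2 * y k := by
    intro k
    have hwk : |w k| ≤ ‖w‖ := norm_le_pi_norm w k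
    have hyk := hypos k
    -- The scalar inequality is used with `r = z k / y k` and `v = 2 η y k w k`; the factor `2`
    -- makes only half of the divergence necessary.
    have hv : |2 * η * (y k * w k)| ≤ 1 / 2 := by
      rw [abs_mul (2 * η), abs_mul (y k), abs_of_pos (by positivity : 0 < 2 * η), abs_of_pos hyk]
      have : y k * |w k| ≤ ‖w‖ := by
        calc y k * |w k| ≤ 1 * ‖w‖ := by gcongr; exact hy1 k
          _ = ‖w‖ := one_mul _
      nlinarith
    have h := mul_sub_one_le_sub_log (div_pos (hz k) hyk) hv
    have e1 : (z k - y k) * w k = (2 * η * (y k * w k) * (z k / y k - 1)) / (2 * η) := by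
      field_simp
    rw [e1]
    have e2 : (z k / y k - 1 - Real.log (z k / y k)) / (2 * η) + 4 * η * ‖w‖ ^ 2 * y k
      = ((z k / y k - 1 - Real.log (z k / y k)) + 2 * ((2 * η) ^ 2 * (‖w‖ ^ 2 * y k))) / (2 * η) := by
      field_simp
      ring
    rw [e2]
    gcongr
    refine h.trans ?_
    have h5 : (y k * w k) ^ 2 ≤ ‖w‖ ^ 2 * y k := by
      have : w k ^ 2 ≤ ‖w‖ ^ 2 := by rw [← sq_abs]; gcongr
      -- Keeping one factor `y k` lets the error terms sum to `‖w‖²`, with no factor for the number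
      -- of coordinates.
      have h6 : y k ^ 2 ≤ y k := by nlinarith [hy1 k]
      calc (y k * w k) ^ 2 = w k ^ 2 * y k ^ 2 := by ring
        _ ≤ ‖w‖ ^ 2 * y k := by gcongr
    have : (2 * η * (y k * w k)) ^ 2 ≤ (2 * η) ^ 2 * (‖w‖ ^ 2 * y k) := by
      rw [mul_pow (2 * η)]; gcongr
    linarith
  calc (z - y) ⬝ᵥ w = ∑ k, (z k - y k) * w k := by simp [dotProduct]
    _ ≤ ∑ k, ((z k / y k - 1 - Real.log (z k / y k)) / (2 * η) + 4 * η * ‖w‖ ^ 2 * y k) :=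
        Finset.sum_le_sum fun k _ => hterm k
    _ = _ := by
      rw [Finset.sum_add_distrib, ← Finset.sum_div, ← Finset.mul_sum, hy.2, mul_one]
      rfl

/-- Regret bound for optimistic FTRL with the logarithmic barrier, with nonincreasing learning
rates and the last gradient as prediction; round `t + 1` is indexed by `t`. -/
theorem oftrl_regret_bound {g y : ℕ → α → ℝ} {η : ℕ → ℝ} {c : α → ℝ} (N : ℕ) (hg0 : g 0 = 0)
    (hη : ∀ t ≤ N, 0 < η t) (hanti : ∀ t < N, η (t + 1) ≤ η t)
    (hy : ∀ t ≤ N, IsBarrierMaximizer (g t + ∑ s ∈ Finset.range t, g (s + 1)) (η t) (y t))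
    (hsmall : ∀ t < N, η t * ‖g (t + 1) - g t‖ ≤ 1 / 4)
    (hc : c ∈ stdSimplex ℝ α) (hcpos : ∀ k, 0 < c k) :
    ∑ t ∈ Finset.range N, (c - y t) ⬝ᵥ g (t + 1) ≤
      (logBarrier c - Fintype.card α * Real.log (Fintype.card α)) / η N + (y N - c) ⬝ᵥ g N +
        ∑ t ∈ Finset.range N,
          (4 * η t * ‖g (t + 1) - g t‖ ^ 2 - barrierDivergence (y (t + 1)) (y t) / (2 * η t)) := by
  set φ₀ : ℝ := Fintype.card α * Real.log (Fintype.card α) with hφ₀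
  -- The right side is the minimal value of the regularized objective of index `K`. Passing from `y
  -- K` to `y (K + 1)` costs the full divergence over `η K`: half pays for the error `g (K + 1) - g
  -- K` of the prediction, half is kept for the final bound.
  have main : ∀ K ≤ N, (∑ t ∈ Finset.range K,
      (- (4 * η t * ‖g (t + 1) - g t‖ ^ 2) + barrierDivergence (y (t + 1)) (y t) / (2 * η t)
        - y t ⬝ᵥ g (t + 1))) - y K ⬝ᵥ g K ≤
      (logBarrier (y K) - φ₀) / η K - y K ⬝ᵥ (g K + ∑ s ∈ Finset.range K, g (s + 1)) := by
    intro K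
    induction K with
    | zero =>
      intro h0
      have := card_mul_log_le_logBarrier (hy 0 h0).1.1 (hy 0 h0).1.2
      have h2 : 0 ≤ (logBarrier (y 0) - φ₀) / η 0 :=
        div_nonneg (by linarith) (hη 0 h0).le
      simpa [hg0] using h2
    | succ K ih =>
      intro hK
      have ih := ih (by omega)
      have hK' : K ≤ N := by omega
      have ho := (hy K hK').objective_eq (hy (K + 1) hK).1.1 (hy (K + 1) hK).1.2
      have hst := dotProduct_le_divergence (hη K hK') (hy (K + 1) hK).1.2 (hy K hK').1.1
        (hy K hK').1.2 (hsmall K hK)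
      -- Subtracting the minimum `φ₀` makes the barrier nonnegative, so a smaller learning rate can
      -- only increase this term.
      have hφ : (logBarrier (y (K + 1)) - φ₀) / η K ≤ (logBarrier (y (K + 1)) - φ₀) / η (K + 1) := by
        have := card_mul_log_le_logBarrier (hy (K + 1) hK).1.1 (hy (K + 1) hK).1.2
        exact div_le_div_of_nonneg_left (by linarith) (hη _ hK) (hanti K hK)
      have hhalf : barrierDivergence (y (K + 1)) (y K) / η K
          = 2 * (barrierDivergence (y (K + 1)) (y K) / (2 * η K)) := by
        have := (hη K hK').ne'
        field_simp
      rw [Finset.sum_range_succ, Finset.sum_range_succ]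
      simp only [dotProduct_add, sub_dotProduct, dotProduct_sub, sub_div] at *
      linarith
  have hN := main N le_rfl
  have hfin := (hy N le_rfl).objective_eq hc hcpos
  have hD : 0 ≤ barrierDivergence c (y N) / η N :=
    div_nonneg (barrierDivergence_nonneg hcpos (hy N le_rfl).1.2) (hη N le_rfl).le
  have hsum : ∑ t ∈ Finset.range N, c ⬝ᵥ g (t + 1) = c ⬝ᵥ ∑ s ∈ Finset.range N, g (s + 1) := by
    rw [dotProduct_sum]
  simp only [sub_dotProduct, Finset.sum_sub_distrib, dotProduct_add, sub_div,
    Finset.sum_add_distrib, Finset.sum_neg_distrib] at *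
  linarith

end OFTRL

/-! ### Stability of stationary distributions -/

section Stationary

variable {α : Type*} [Fintype α]

/-- `Q` is a transition kernel with positive entries. -/
def IsPositiveKernel (Q : α → α → ℝ) : Prop := ∀ a, Q a ∈ stdSimplex ℝ α ∧ ∀ k, 0 < Q a k

/-- `p` is a stationary distribution of `Q`. -/
def IsStationary (Q : α → α → ℝ) (p : α → ℝ) : Prop :=
  p ∈ stdSimplex ℝ α ∧ ∀ k, ∑ a, p a * Q a k = p k

theorem IsStationary.pos {Q : α → α → ℝ} {p : α → ℝ} (hQ : IsPositiveKernel Q)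
    (hp : IsStationary Q p) (k : α) : 0 < p k := by
  obtain ⟨a, -, ha⟩ : ∃ a ∈ Finset.univ, 0 < p a := by
    apply Finset.exists_lt_of_sum_lt (f := fun _ => (0 : ℝ))
    rw [hp.1.2]; simp
  rw [← hp.2 k]
  exact Finset.sum_pos' (fun b _ => mul_nonneg (hp.1.1 b) ((hQ b).2 k).le)
    ⟨a, Finset.mem_univ a, mul_pos ha ((hQ a).2 k)⟩

theorem l1_dist_le_two {p q : α → ℝ} (hp : p ∈ stdSimplex ℝ α) (hq : q ∈ stdSimplex ℝ α) :
    ∑ k, |q k - p k| ≤ 2 := by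
  calc ∑ k, |q k - p k| ≤ ∑ k, (q k + p k) := Finset.sum_le_sum fun k _ => by
        rw [abs_le]; constructor <;> linarith [hp.1 k, hq.1 k]
    _ = 2 := by rw [Finset.sum_add_distrib, hp.2, hq.2]; norm_num

variable [DecidableEq α]

/-- Constants are fixed by `Q`, so `1` is also a left eigenvalue, with eigenvector `w`. Then `|w| ≤
|w| Q` entrywise while both sides have the same total mass, so equality holds and `|w|` can be
normalized. -/
theorem exists_isStationary [Nonempty α] {Q : α → α → ℝ} (hQ : IsPositiveKernel Q) :
    ∃ p, IsStationary Q p := by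
  have h1 : ((1 - Matrix.of Q : Matrix α α ℝ)).det = 0 := by
    apply Matrix.exists_mulVec_eq_zero_iff.1
    refine ⟨fun _ => 1, fun h => ?_, ?_⟩
    · have := congrFun h (Classical.arbitrary α)
      simp at this
    · rw [Matrix.sub_mulVec, Matrix.one_mulVec]
      funext a
      simp [Matrix.mulVec, dotProduct, (hQ a).1.2]
  obtain ⟨w, hw0, hw⟩ := Matrix.exists_vecMul_eq_zero_iff.2 h1
  rw [Matrix.vecMul_sub, Matrix.vecMul_one, sub_eq_zero] at hw
  have hw' : ∀ k, ∑ a, w a * Q a k = w k := fun k => (congrFun hw k).symm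
  have hle : ∀ k ∈ Finset.univ, |w k| ≤ ∑ a, |w a| * Q a k := by
    intro k _
    rw [← hw' k]
    refine (Finset.abs_sum_le_sum_abs _ _).trans_eq (Finset.sum_congr rfl fun a _ => ?_)
    rw [abs_mul, abs_of_pos ((hQ a).2 k)]
  have hsum : ∑ k, |w k| = ∑ k, ∑ a, |w a| * Q a k := by
    rw [Finset.sum_comm]
    refine Finset.sum_congr rfl fun a _ => ?_
    rw [← Finset.mul_sum, (hQ a).1.2, mul_one]
  have heq := (Finset.sum_eq_sum_iff_of_le hle).1 hsum
  have hpos : 0 < ∑ k, |w k| := by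
    obtain ⟨k, hk⟩ := Function.ne_iff.1 hw0
    exact Finset.sum_pos' (fun _ _ => abs_nonneg _) ⟨k, Finset.mem_univ k, abs_pos.2 hk⟩
  refine ⟨fun k => |w k| / ∑ k, |w k|, ⟨fun k => by positivity, ?_⟩, fun k => ?_⟩
  · rw [← Finset.sum_div, div_self hpos.ne']
  · dsimp only
    rw [heq k (Finset.mem_univ k), Finset.sum_div]
    refine Finset.sum_congr rfl fun a _ => by ring

/-- A maximum principle for the chain killed at `a`. -/
theorem nonneg_of_superharmonic {Q : α → α → ℝ} (hQ : IsPositiveKernel Q) {a : α} {z : α → ℝ}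
    (ha : 0 ≤ z a) (hz : ∀ k, k ≠ a → ∑ j ∈ Finset.univ.erase a, z j * Q j k ≤ z k) (k : α) :
    0 ≤ z k := by
  set w : α → ℝ := fun k => max (-z k) 0 with hw
  have hw0 : ∀ k, 0 ≤ w k := fun k => le_max_right _ _
  have hwa : w a = 0 := max_eq_right (by linarith)
  -- Here `w` is the negative part of `z`. It vanishes at `a` and satisfies `w ≤ w Q` elsewhere.
  -- Since `Q` conserves mass, summing over `k` shows that no mass flows into `a`; as all entries of
  -- `Q` are positive, `w = 0`.
  have hstep : ∀ k, w k ≤ ∑ j, w j * Q j k - if k = a then ∑ j, w j * Q j a else 0 := by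
    intro k
    by_cases hk : k = a
    · subst hk; simp [hwa]
    · simp only [hk, if_false, sub_zero]
      refine max_le ?_ (Finset.sum_nonneg fun j _ => mul_nonneg (hw0 j) ((hQ j).2 k).le)
      have h1 : ∑ j, w j * Q j k = ∑ j ∈ Finset.univ.erase a, w j * Q j k := by
        rw [← Finset.add_sum_erase _ _ (Finset.mem_univ a), hwa]; simp
      have h2 : ∑ j ∈ Finset.univ.erase a, -z j * Q j k ≤ ∑ j ∈ Finset.univ.erase a, w j * Q j k :=
        Finset.sum_le_sum fun j _ => mul_le_mul_of_nonneg_right (le_max_left _ _) ((hQ j).2 k).le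
      simp only [neg_mul, Finset.sum_neg_distrib] at h2
      linarith [hz k hk]
  have hsum := Finset.sum_le_sum fun k (_ : k ∈ Finset.univ) => hstep k
  rw [Finset.sum_sub_distrib, Finset.sum_comm] at hsum
  simp only [← Finset.mul_sum, (hQ _).1.2, mul_one, Finset.sum_ite_eq', Finset.mem_univ,
    if_true] at hsum
  have h3 : w k * Q k a ≤ 0 :=
    (Finset.single_le_sum (f := fun j => w j * Q j a)
      (fun j _ => mul_nonneg (hw0 j) ((hQ j).2 a).le) (Finset.mem_univ k)).trans (by linarith)
  have h4 : w k ≤ 0 := nonpos_of_mul_nonpos_left h3 ((hQ k).2 a)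
  have := le_max_left (-z k) 0
  change -z k ≤ w k at this
  linarith

/-- Stability under a perturbation of a single row. -/
theorem IsStationary.l1_dist_le_of_row {Q Q' : α → α → ℝ} (hQ : IsPositiveKernel Q)
    (hQ' : IsPositiveKernel Q') {p p' : α → ℝ} (hp : IsStationary Q p) (hp' : IsStationary Q' p')
    {a : α} {μ : ℝ} (heq : ∀ j, j ≠ a → Q' j = Q j)
    (hμ : ∀ k, |Q' a k - Q a k| ≤ μ * Q a k) :
    ∑ k, |p' k - p k| ≤ 4 * min μ 1 := by
  have h2 := l1_dist_le_two hp.1 hp'.1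
  have hμ0 : 0 ≤ μ := by
    have h := (abs_nonneg _).trans (hμ a)
    exact nonneg_of_mul_nonneg_left h ((hQ a).2 a)
  rcases le_or_gt (1 / 2) μ with hμ2 | hμ2
  -- For `μ ≥ 1/2` the claim follows from the trivial bound `2` on the `ℓ¹` distance.
  · have : 1 / 2 ≤ min μ 1 := le_min hμ2 (by norm_num)
    linarith
  rw [min_eq_left (by linarith)]
  have hpa := hp.pos hQ a
  have hpa' := hp'.pos hQ' a
  have split : ∀ k, p k = p a * Q a k + ∑ j ∈ Finset.univ.erase a, p j * Q j k := fun k => by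
    rw [Finset.add_sum_erase _ (fun j => p j * Q j k) (Finset.mem_univ a), hp.2 k]
  have split' : ∀ k, p' k = p' a * Q' a k + ∑ j ∈ Finset.univ.erase a, p' j * Q j k := fun k => by
    rw [← hp'.2 k, ← Finset.add_sum_erase _ _ (Finset.mem_univ a)]
    congr 1
    refine Finset.sum_congr rfl fun j hj => ?_
    rw [heq j (Finset.ne_of_mem_erase hj)]
  have hprod : 0 ≤ p a * p' a := (mul_pos hpa hpa').le
  -- Away from `a` both distributions solve the same killed equation, with sources `p a • Q a` and
  -- `p' a • Q' a`. After scaling to equal mass at `a`, the sources differ by a factor in `[1 - μ, 1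
  -- + μ]`, and the maximum principle transfers this to the solutions.
  have hup : ∀ k, 0 ≤ (1 + μ) * p' a * p k - p a * p' k := by
    refine nonneg_of_superharmonic hQ (a := a) (by nlinarith) fun k _ => ?_
    have e : ∑ j ∈ Finset.univ.erase a, ((1 + μ) * p' a * p j - p a * p' j) * Q j k
        = (1 + μ) * p' a * ∑ j ∈ Finset.univ.erase a, p j * Q j k
          - p a * ∑ j ∈ Finset.univ.erase a, p' j * Q j k := by
      rw [Finset.mul_sum, Finset.mul_sum, ← Finset.sum_sub_distrib]
      exact Finset.sum_congr rfl fun j _ => by ring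
    rw [e]
    have h3 := (abs_le.1 (hμ k)).2
    have h4 : 0 ≤ p a * p' a * ((1 + μ) * Q a k - Q' a k) := mul_nonneg hprod (by linarith)
    have h5 : (1 + μ) * p' a * p k - p a * p' k
        = (1 + μ) * p' a * (∑ j ∈ Finset.univ.erase a, p j * Q j k)
          - p a * (∑ j ∈ Finset.univ.erase a, p' j * Q j k)
          + p a * p' a * ((1 + μ) * Q a k - Q' a k) := by
      nth_rewrite 1 [split k, split' k]; ring
    linarith
  have hlow : ∀ k, 0 ≤ p a * p' k - (1 - μ) * p' a * p k := by
    refine nonneg_of_superharmonic hQ (a := a) (by nlinarith) fun k _ => ?_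
    have e : ∑ j ∈ Finset.univ.erase a, (p a * p' j - (1 - μ) * p' a * p j) * Q j k
        = p a * (∑ j ∈ Finset.univ.erase a, p' j * Q j k)
          - (1 - μ) * p' a * ∑ j ∈ Finset.univ.erase a, p j * Q j k := by
      rw [Finset.mul_sum, Finset.mul_sum, ← Finset.sum_sub_distrib]
      exact Finset.sum_congr rfl fun j _ => by ring
    rw [e]
    have h3 := (abs_le.1 (hμ k)).1
    have h4 : 0 ≤ p a * p' a * (Q' a k - (1 - μ) * Q a k) := mul_nonneg hprod (by linarith)
    have h5 : p a * p' k - (1 - μ) * p' a * p k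
        = p a * (∑ j ∈ Finset.univ.erase a, p' j * Q j k)
          - (1 - μ) * p' a * (∑ j ∈ Finset.univ.erase a, p j * Q j k)
          + p a * p' a * (Q' a k - (1 - μ) * Q a k) := by
      nth_rewrite 1 [split k, split' k]; ring
    linarith
  set ρ := p' a / p a with hρ
  have hρ0 : 0 < ρ := div_pos hpa' hpa
  have hρa : p' a = ρ * p a := by rw [hρ]; field_simp
  have hup' : ∀ k, p' k ≤ (1 + μ) * ρ * p k := fun k => by
    have := hup k
    rw [hρa] at this
    have h6 : 0 ≤ p a * ((1 + μ) * ρ * p k - p' k) := by linarith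
    linarith [nonneg_of_mul_nonneg_right h6 hpa]
  have hlow' : ∀ k, (1 - μ) * ρ * p k ≤ p' k := fun k => by
    have := hlow k
    rw [hρa] at this
    have h6 : 0 ≤ p a * (p' k - (1 - μ) * ρ * p k) := by linarith
    linarith [nonneg_of_mul_nonneg_right h6 hpa]
  -- Total mass one on both sides gives `1 / (1 + μ) ≤ ρ ≤ 1 / (1 - μ)`; in particular `ρ ≤ 2`, the
  -- source of the constant `4`.
  have s1 : 1 ≤ (1 + μ) * ρ := by
    have := Finset.sum_le_sum fun k (_ : k ∈ Finset.univ) => hup' k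
    rwa [← Finset.mul_sum, hp.1.2, hp'.1.2, mul_one] at this
  have s2 : (1 - μ) * ρ ≤ 1 := by
    have := Finset.sum_le_sum fun k (_ : k ∈ Finset.univ) => hlow' k
    rwa [← Finset.mul_sum, hp.1.2, hp'.1.2, mul_one] at this
  have hterm : ∀ k, |p' k - p k| ≤ 2 * μ * ρ * p k := by
    intro k
    have hk := hp.1.1 k
    have e1 := mul_le_mul_of_nonneg_right s1 hk
    have e2 := mul_le_mul_of_nonneg_right s2 hk
    have := hup' k
    have := hlow' k
    rw [abs_le]; constructor <;> nlinarith
  have hsum := Finset.sum_le_sum fun k (_ : k ∈ Finset.univ) => hterm k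
  rw [← Finset.mul_sum, hp.1.2, mul_one] at hsum
  nlinarith

/-- Stability of stationary distributions under relative perturbations of the rows. -/
theorem IsStationary.l1_dist_le {Q Q' : α → α → ℝ} (hQ : IsPositiveKernel Q)
    (hQ' : IsPositiveKernel Q') {p p' : α → ℝ} (hp : IsStationary Q p) (hp' : IsStationary Q' p')
    {μ : α → ℝ} (hμ : ∀ a k, |Q' a k - Q a k| ≤ μ a * Q a k) :
    ∑ k, |p' k - p k| ≤ 4 * ∑ a, min (μ a) 1 := by
  have hne : Nonempty α := by
    by_contra h
    rw [not_nonempty_iff] at h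
    have := hp.1.2
    simp at this
  -- Rows are replaced one at a time, through stationary distributions of the intermediate kernels.
  -- The empty case is uniqueness of the stationary distribution, obtained from the one-row bound
  -- with `μ = 0`.
  suffices H : ∀ s : Finset α, ∀ q, IsStationary (fun a => if a ∈ s then Q' a else Q a) q →
      ∑ k, |q k - p k| ≤ 4 * ∑ a ∈ s, min (μ a) 1 from
    H Finset.univ p' (by simpa using hp')
  have hker : ∀ s : Finset α, IsPositiveKernel (fun a => if a ∈ s then Q' a else Q a) := by
    intro s a
    dsimp only
    split_ifs
    · exact hQ' a
    · exact hQ a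
  intro s
  induction s using Finset.induction_on with
  | empty =>
    intro q hq
    have hq' : IsStationary Q q := by simpa using hq
    have := IsStationary.l1_dist_le_of_row hQ hQ hp hq' (a := Classical.arbitrary α) (μ := 0)
      (fun _ _ => rfl) (by simp)
    simpa using this
  | insert b s hb ih =>
    intro q hq
    obtain ⟨q₀, hq₀⟩ := exists_isStationary (hker s)
    have h1 := ih q₀ hq₀
    have h2 := IsStationary.l1_dist_le_of_row (hker s) (hker (insert b s)) hq₀ hq (a := b)
      (μ := μ b) (fun j hj => by simp [hj]) (fun k => by simpa [hb] using hμ b k)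
    rw [Finset.sum_insert hb]
    calc ∑ k, |q k - p k| ≤ ∑ k, (|q k - q₀ k| + |q₀ k - p k|) :=
          Finset.sum_le_sum fun k _ => abs_sub_le _ _ _
      _ ≤ _ := by rw [Finset.sum_add_distrib]; linarith

/-- The squared `ℓ¹`-distance of stationary distributions is bounded by the barrier divergences of
the rows. -/
theorem IsStationary.sq_l1_dist_le {Q Q' : α → α → ℝ} (hQ : IsPositiveKernel Q)
    (hQ' : IsPositiveKernel Q') {p p' : α → ℝ} (hp : IsStationary Q p)
    (hp' : IsStationary Q' p') :
    (∑ k, |p' k - p k|) ^ 2 ≤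
      144 * Fintype.card α * ∑ a, barrierDivergence (Q' a) (Q a) := by
  set μ : α → ℝ := fun a => ‖fun k => Q' a k / Q a k - 1‖ with hμ
  have h1 : ∀ a k, |Q' a k - Q a k| ≤ μ a * Q a k := by
    intro a k
    have hk := (hQ a).2 k
    have h := norm_le_pi_norm (fun k => Q' a k / Q a k - 1) k
    have e : Q' a k - Q a k = (Q' a k / Q a k - 1) * Q a k := by field_simp
    rw [e, abs_mul, abs_of_pos hk]
    exact mul_le_mul_of_nonneg_right h hk.le
  have h2 : ∀ a, (min (μ a) 1) ^ 2 ≤ 9 * barrierDivergence (Q' a) (Q a) := by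
    intro a
    have : Nonempty α := ⟨a⟩
    obtain ⟨k, hk⟩ : ∃ k, μ a = |Q' a k / Q a k - 1| := by
      obtain ⟨k, hk⟩ := Finite.exists_max fun k => |Q' a k / Q a k - 1|
      refine ⟨k, le_antisymm ?_ (norm_le_pi_norm (fun k => Q' a k / Q a k - 1) k)⟩
      exact (pi_norm_le_iff_of_nonneg (abs_nonneg _)).2 hk
    rw [hk]
    exact sq_min_abs_le_barrierDivergence (hQ' a).2 (hQ a).2 k
  have h3 := IsStationary.l1_dist_le hQ hQ' hp hp' h1
  -- The constant is `144 = 4² · 9`; the factor `card α` comes from Cauchy–Schwarz over the rows.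
  have h4 : (∑ k, |p' k - p k|) ^ 2 ≤ (4 * ∑ a, min (μ a) 1) ^ 2 :=
    pow_le_pow_left₀ (Finset.sum_nonneg fun _ _ => abs_nonneg _) h3 2
  have h5 : (∑ a, min (μ a) 1) ^ 2 ≤ Fintype.card α * ∑ a, (min (μ a) 1) ^ 2 := by
    simpa using sq_sum_le_card_mul_sum_sq (s := Finset.univ) (f := fun a => min (μ a) 1)
  have h6 : ∑ a, (min (μ a) 1) ^ 2 ≤ 9 * ∑ a, barrierDivergence (Q' a) (Q a) := by
    rw [Finset.mul_sum]; exact Finset.sum_le_sum fun a _ => h2 a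
  have h7 : (Fintype.card α : ℝ) * ∑ a, (min (μ a) 1) ^ 2
      ≤ Fintype.card α * (9 * ∑ a, barrierDivergence (Q' a) (Q a)) := by gcongr
  nlinarith

end Stationary

/-! ### Regret of the experts of a single player -/

section Learner

variable {α : Type*} [Fintype α]

theorem le_one_of_mem_stdSimplex {p : α → ℝ} (hp : p ∈ stdSimplex ℝ α) (k : α) : p k ≤ 1 := by
  rw [← hp.2]; exact Finset.single_le_sum (fun k _ => hp.1 k) (Finset.mem_univ k)

theorem abs_dotProduct_le_norm {p w : α → ℝ} (hp : p ∈ stdSimplex ℝ α) : |p ⬝ᵥ w| ≤ ‖w‖ := by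
  calc |p ⬝ᵥ w| ≤ ∑ k, |p k * w k| := Finset.abs_sum_le_sum_abs _ _
    _ ≤ ∑ k, p k * ‖w‖ := by
        refine Finset.sum_le_sum fun k _ => ?_
        rw [abs_mul, abs_of_nonneg (hp.1 k)]
        exact mul_le_mul_of_nonneg_left (norm_le_pi_norm w k) (hp.1 k)
    _ = ‖w‖ := by rw [← Finset.sum_mul, hp.2, one_mul]

theorem sum_sq_le_sq_l1 (w : α → ℝ) : ∑ a, w a ^ 2 ≤ (∑ a, |w a|) ^ 2 := by
  simp_rw [← sq_abs (w _)]
  exact Finset.sum_sq_le_sq_sum_of_nonneg fun a _ => abs_nonneg _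

/-- Write `p a • w - q a • z = p a • (w - z) + (p a - q a) • z`. Because `p a ^ 2 ≤ p a`, all
experts of a player together pay for the movement of the gradient only once. -/
theorem sum_sq_norm_smul_sub_le {p q : α → ℝ} (hp : p ∈ stdSimplex ℝ α) (w z : α → ℝ) :
    ∑ a, ‖p a • w - q a • z‖ ^ 2 ≤ 2 * ‖w - z‖ ^ 2 + 2 * ((∑ a, |p a - q a|) ^ 2 * ‖z‖ ^ 2) := by
  have hterm : ∀ a, ‖p a • w - q a • z‖ ^ 2
      ≤ 2 * (p a * ‖w - z‖ ^ 2) + 2 * ((p a - q a) ^ 2 * ‖z‖ ^ 2) := by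
    intro a
    have e : p a • w - q a • z = p a • (w - z) + (p a - q a) • z := by
      rw [smul_sub, sub_smul]; abel
    have h1 : ‖p a • w - q a • z‖ ≤ p a * ‖w - z‖ + |p a - q a| * ‖z‖ := by
      rw [e]
      refine (norm_add_le _ _).trans_eq ?_
      rw [norm_smul, norm_smul, Real.norm_eq_abs, Real.norm_eq_abs, abs_of_nonneg (hp.1 a)]
    have h2 := pow_le_pow_left₀ (norm_nonneg _) h1 2
    have h3 : (p a * ‖w - z‖) ^ 2 ≤ p a * ‖w - z‖ ^ 2 := by
      rw [mul_pow]
      have : p a ^ 2 ≤ p a := by nlinarith [hp.1 a, le_one_of_mem_stdSimplex hp a]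
      gcongr
    have h4 : (|p a - q a| * ‖z‖) ^ 2 = (p a - q a) ^ 2 * ‖z‖ ^ 2 := by rw [mul_pow, sq_abs]
    nlinarith [sq_nonneg (p a * ‖w - z‖ - |p a - q a| * ‖z‖)]
  refine (Finset.sum_le_sum fun a _ => hterm a).trans ?_
  rw [Finset.sum_add_distrib, ← Finset.mul_sum, ← Finset.mul_sum, ← Finset.sum_mul,
    ← Finset.sum_mul, hp.2, one_mul]
  have := sum_sq_le_sq_l1 fun a => p a - q a
  gcongr

/-- The regret of the experts of one player who plays stationary distributions, in terms of the
path length of the gradients `h` and of the movement of the strategies; the learning rate of round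
`t + 1` is `η t`. -/
theorem experts_regret_bound [DecidableEq α] {x h : ℕ → α → ℝ} {y : ℕ → α → α → ℝ} {η : ℕ → ℝ}
    {c : α → α → ℝ} {Λ : ℝ} (N : ℕ) (h0 : h 0 = 0)
    (hη : ∀ t ≤ N, 0 < η t) (hanti : ∀ t < N, η (t + 1) ≤ η t)
    (hy : ∀ t ≤ N, ∀ a, IsBarrierMaximizer
      (x t a • h t + ∑ s ∈ Finset.range t, x (s + 1) a • h (s + 1)) (η t) (y (t + 1) a))
    (hx : ∀ t ≤ N, IsStationary (y (t + 1)) (x (t + 1)))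
    (hsmall : ∀ t < N, η t * ‖h (t + 1)‖ ≤ 1 / (128 * √(Fintype.card α)))
    (hc : IsPositiveKernel c)
    (hΛ : ∀ a, logBarrier (c a) - Fintype.card α * Real.log (Fintype.card α) ≤ Fintype.card α * Λ) :
    ∑ t ∈ Finset.range N, ∑ a, (c a - y (t + 1) a) ⬝ᵥ (x (t + 1) a • h (t + 1)) ≤
      (Fintype.card α : ℝ) ^ 2 * Λ / η N + 2 * ‖h N‖
        + 8 * ∑ t ∈ Finset.range N, η t * ‖h (t + 1) - h t‖ ^ 2
        - ∑ t ∈ Finset.range N,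
            (∑ a, |x (t + 2) a - x (t + 1) a|) ^ 2 / (576 * Fintype.card α * η t) := by
  have hne : Nonempty α := by
    by_contra hcon
    rw [not_nonempty_iff] at hcon
    have := (hx 0 (Nat.zero_le _)).1.2
    simp at this
  set m : ℝ := (Fintype.card α : ℝ) with hm
  have hm1 : 1 ≤ m := by rw [hm]; exact_mod_cast Fintype.card_pos
  have hsm1 : 1 ≤ √m := Real.one_le_sqrt.2 hm1
  have hker : ∀ t ≤ N, IsPositiveKernel (y (t + 1)) := fun t ht a => (hy t ht a).1
  set D : ℕ → ℝ := fun t => ∑ a, barrierDivergence (y (t + 2) a) (y (t + 1) a) with hD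
  have hD0 : ∀ t < N, 0 ≤ D t := fun t ht => Finset.sum_nonneg fun a _ =>
    barrierDivergence_nonneg (hker (t + 1) ht a).2 (hker t ht.le a).2
  have hstab : ∀ t < N, (∑ a, |x (t + 2) a - x (t + 1) a|) ^ 2 ≤ 144 * m * D t := fun t ht =>
    IsStationary.sq_l1_dist_le (hker t ht.le) (hker (t + 1) ht) (hx t ht.le) (hx (t + 1) ht)
  have hprev : ∀ t < N, η t * ‖h t‖ ≤ 1 / (128 * √m) := by
    intro t ht
    rcases t with _ | t
    · rw [h0, norm_zero, mul_zero]; positivity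
    · exact (mul_le_mul_of_nonneg_right (hanti t (by omega)) (norm_nonneg _)).trans
        (hsmall t (by omega))
  have hexp : ∀ a, ∑ t ∈ Finset.range N, (c a - y (t + 1) a) ⬝ᵥ (x (t + 1) a • h (t + 1)) ≤
      m * Λ / η N + 2 * (if N = 0 then 0 else x N a) * ‖h N‖ +
        ∑ t ∈ Finset.range N,
          (4 * η t * ‖x (t + 1) a • h (t + 1) - x t a • h t‖ ^ 2
            - barrierDivergence (y (t + 2) a) (y (t + 1) a) / (2 * η t)) := by
    intro a
    have hle : ∀ t < N, ∀ w : α → ℝ, ‖x (t + 1) a • w‖ ≤ ‖w‖ := by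
      intro t ht w
      rw [norm_smul, Real.norm_eq_abs, abs_of_nonneg ((hx t ht.le).1.1 a)]
      exact mul_le_of_le_one_left (norm_nonneg _) (le_one_of_mem_stdSimplex (hx t ht.le).1 a)
    have hsm : ∀ t < N, η t * ‖x (t + 1) a • h (t + 1) - x t a • h t‖ ≤ 1 / 4 := by
      intro t ht
      have h1 : ‖x t a • h t‖ ≤ ‖h t‖ := by
        rcases t with _ | t
        · simp [h0]
        · exact hle t (by omega) _
      have h2 := (norm_sub_le (x (t + 1) a • h (t + 1)) (x t a • h t)).trans
        (add_le_add (hle t ht (h (t + 1))) h1)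
      have h3 := mul_le_mul_of_nonneg_left h2 (hη t ht.le).le
      have h4 : 1 / (128 * √m) ≤ 1 / 8 := by
        apply one_div_le_one_div_of_le <;> linarith
      have := hsmall t ht
      have := hprev t ht
      linarith
    have hb := oftrl_regret_bound (g := fun t => x t a • h t) (y := fun t => y (t + 1) a) N
      (by simp [h0]) hη hanti (fun t ht => hy t ht a) hsm (hc a).1 (hc a).2
    refine hb.trans ?_
    gcongr
    · exact (hη N le_rfl).le
    · exact hΛ a
    · rcases N with _ | N
      · simp [h0]
      · simp only [Nat.add_eq_zero_iff, one_ne_zero, and_false, if_false]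
        rw [dotProduct_smul, sub_dotProduct, smul_eq_mul]
        have h1 := (abs_le.1 (abs_dotProduct_le_norm (w := h (N + 1)) (hy (N + 1) le_rfl a).1.1)).2
        have h2 := (abs_le.1 (abs_dotProduct_le_norm (w := h (N + 1)) (hc a).1)).1
        have h3 := (hx N (by omega)).1.1 a
        have := mul_le_mul_of_nonneg_left
          (by linarith : y (N + 1 + 1) a ⬝ᵥ h (N + 1) - c a ⬝ᵥ h (N + 1) ≤ 2 * ‖h (N + 1)‖) h3
        linarith
  rw [Finset.sum_comm]
  refine (Finset.sum_le_sum fun a _ => hexp a).trans ?_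
  rw [Finset.sum_add_distrib, Finset.sum_add_distrib, Finset.sum_comm]
  have t1 : ∑ _a : α, m * Λ / η N = m ^ 2 * Λ / η N := by
    rw [Finset.sum_const, Finset.card_univ, nsmul_eq_mul, ← hm]; ring
  have t2 : ∑ a, 2 * (if N = 0 then 0 else x N a) * ‖h N‖ ≤ 2 * ‖h N‖ := by
    rcases N with _ | N
    · simp [h0]
    · simp only [Nat.add_eq_zero_iff, one_ne_zero, and_false, if_false]
      rw [← Finset.sum_mul, ← Finset.mul_sum, (hx N (by omega)).1.2, mul_one]
  -- Movement of the expert gradients is movement of `h` plus movement of the strategies. The latter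
  -- was caused by the row changes `D (t - 1)`, and the small rate makes it at most half of the
  -- negative term `D (t - 1) / (2 η (t - 1))` of the previous round.
  have t3 : ∀ t < N, ∑ a, (4 * η t * ‖x (t + 1) a • h (t + 1) - x t a • h t‖ ^ 2
      - barrierDivergence (y (t + 2) a) (y (t + 1) a) / (2 * η t)) ≤
      8 * (η t * ‖h (t + 1) - h t‖ ^ 2)
        + (if t = 0 then 0 else D (t - 1) / (4 * η (t - 1))) - D t / (2 * η t) := by
    intro t ht
    have hηt := hη t ht.le
    rw [Finset.sum_sub_distrib, ← Finset.mul_sum, ← Finset.sum_div]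
    have h1 := mul_le_mul_of_nonneg_left
      (sum_sq_norm_smul_sub_le (q := x t) (hx t ht.le).1 (h (t + 1)) (h t))
      (by positivity : 0 ≤ 4 * η t)
    have h2 : 8 * η t * ((∑ a, |x (t + 1) a - x t a|) ^ 2 * ‖h t‖ ^ 2)
        ≤ if t = 0 then 0 else D (t - 1) / (4 * η (t - 1)) := by
      rcases t with _ | t
      -- The vector `x 0` is arbitrary, but it only occurs multiplied by `h 0 = 0`.
      · simp [h0]
      · simp only [Nat.add_eq_zero_iff, one_ne_zero, and_false, if_false, Nat.add_sub_cancel]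
        have hηp := hη t (by omega)
        have hs := hstab t (by omega)
        have hd := hD0 t (by omega)
        have hsq : (η t * ‖h (t + 1)‖) ^ 2 ≤ 1 / (16384 * m) := by
          refine (pow_le_pow_left₀ (by positivity) (hsmall t (by omega)) 2).trans_eq ?_
          rw [div_pow, mul_pow, Real.sq_sqrt (by linarith)]; norm_num
        rw [le_div_iff₀ (by positivity)]
        calc 8 * η (t + 1) * ((∑ a, |x (t + 1 + 1) a - x (t + 1) a|) ^ 2 * ‖h (t + 1)‖ ^ 2)
              * (4 * η t)
            ≤ 8 * η t * ((144 * m * D t) * ‖h (t + 1)‖ ^ 2) * (4 * η t) := by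
              gcongr
              exact hanti t (by omega)
          _ = 4608 * m * D t * (η t * ‖h (t + 1)‖) ^ 2 := by ring
          _ ≤ 4608 * m * D t * (1 / (16384 * m)) := by gcongr
          _ = (4608 / 16384) * D t := by field_simp
          _ ≤ D t := by linarith
    have h3 : ∑ a, barrierDivergence (y (t + 2) a) (y (t + 1) a) = D t := rfl
    rw [h3]
    linarith
  have t4 : ∀ K ≤ N, ∑ t ∈ Finset.range K, ((if t = 0 then 0 else D (t - 1) / (4 * η (t - 1)))
      - D t / (2 * η t)) ≤ - ∑ t ∈ Finset.range K, D t / (4 * η t)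
        - (if K = 0 then 0 else D (K - 1) / (4 * η (K - 1))) := by
    intro K
    induction K with
    | zero => simp
    | succ K ih =>
      intro hK
      have := ih (by omega)
      rw [Finset.sum_range_succ, Finset.sum_range_succ]
      have hhalf : D K / (2 * η K) = 2 * (D K / (4 * η K)) := by
        have := (hη K (by omega)).ne'
        field_simp; norm_num
      simp only [Nat.add_eq_zero_iff, one_ne_zero, and_false, if_false, Nat.add_sub_cancel]
      linarith
  have t5 : 0 ≤ (if N = 0 then 0 else D (N - 1) / (4 * η (N - 1))) := by
    split_ifs with hN
    · exact le_rfl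
    · have := hD0 (N - 1) (by omega)
      have := hη (N - 1) (by omega)
      positivity
  -- The surviving quarter of the divergences becomes strategy movement, with `576 = 4 · 144`.
  have t6 : ∑ t ∈ Finset.range N,
      (∑ a, |x (t + 2) a - x (t + 1) a|) ^ 2 / (576 * m * η t)
      ≤ ∑ t ∈ Finset.range N, D t / (4 * η t) := by
    refine Finset.sum_le_sum fun t ht => ?_
    have ht := Finset.mem_range.1 ht
    have hηt := hη t ht.le
    rw [div_le_div_iff₀ (by positivity) (by positivity)]
    nlinarith [mul_le_mul_of_nonneg_right (hstab t ht) hηt.le]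
  have t7 := Finset.sum_le_sum fun t (ht : t ∈ Finset.range N) => t3 t (Finset.mem_range.1 ht)
  have t8 := t4 N le_rfl
  simp only [add_sub_assoc] at t7
  rw [Finset.sum_add_distrib, ← Finset.mul_sum] at t7
  rw [t1]
  linarith

end Learner

/-! ### Clipping scales -/

theorem nextScale_zero (M : ℝ) : nextScale 0 M = 0 := by simp [nextScale]

theorem le_nextScale {B : ℝ} (hB : 0 ≤ B) (M : ℝ) : B ≤ nextScale B M :=
  le_mul_of_one_le_left hB (one_le_pow₀ one_le_two)

theorem le_two_mul_nextScale {B : ℝ} (hB : 0 < B) (M : ℝ) : M ≤ 2 * nextScale B M := by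
  have hne : {k : ℕ | M ≤ 2 ^ (k + 1) * B}.Nonempty := by
    obtain ⟨k, hk⟩ := pow_unbounded_of_one_lt (M / B) (one_lt_two : (1 : ℝ) < 2)
    refine ⟨k, ?_⟩
    have h1 : M < 2 ^ k * B := by rwa [div_lt_iff₀ hB] at hk
    have h2 : (2 : ℝ) ^ k * B ≤ 2 ^ (k + 1) * B := by
      gcongr
      · norm_num
      · omega
    exact (h1.le.trans h2)
  have h : M ≤ 2 ^ (sInf {k : ℕ | M ≤ 2 ^ (k + 1) * B} + 1) * B := Nat.sInf_mem hne
  unfold nextScale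
  rw [pow_succ] at h
  linarith

theorem nextScale_eq_or_two_mul_le {B : ℝ} (hB : 0 ≤ B) (M : ℝ) :
    nextScale B M = B ∨ 2 * B ≤ nextScale B M := by
  unfold nextScale
  rcases Nat.eq_zero_or_pos (sInf {k : ℕ | M ≤ 2 ^ (k + 1) * B}) with h | h
  · left; rw [h]; simp
  · right
    have : (2 : ℝ) ^ 1 ≤ 2 ^ sInf {k : ℕ | M ≤ 2 ^ (k + 1) * B} :=
      pow_le_pow_right₀ one_le_two h
    nlinarith

theorem nextScale_le_max (B M : ℝ) : nextScale B M ≤ max B M := by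
  unfold nextScale
  rcases Nat.eq_zero_or_pos (sInf {k : ℕ | M ≤ 2 ^ (k + 1) * B}) with h | h
  · rw [h]; simp
  · have hnot : sInf {k : ℕ | M ≤ 2 ^ (k + 1) * B} - 1 ∉ {k : ℕ | M ≤ 2 ^ (k + 1) * B} :=
      Nat.notMem_of_lt_sInf (by omega)
    have hlt : 2 ^ (sInf {k : ℕ | M ≤ 2 ^ (k + 1) * B} - 1 + 1) * B < M := not_le.1 hnot
    rw [Nat.sub_add_cancel h] at hlt
    exact hlt.le.trans (le_max_right _ _)

section Clip

variable {n : ℕ} {A : Fin n → Type*} [∀ i, Fintype (A i)] (g : ℕ → ∀ i, A i → ℝ)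

theorem clipScale_nonneg (t : ℕ) : 0 ≤ clipScale g t := by
  induction t using Nat.strong_induction_on with
  | _ t ih =>
    match t with
    | 0 => exact norm_nonneg _
    | 1 => exact norm_nonneg _
    | t + 2 => exact (ih (t + 1) (by omega)).trans (le_nextScale (ih (t + 1) (by omega)) _)

theorem clipScale_eq_or_two_mul_le (t : ℕ) :
    clipScale g (t + 1) = clipScale g t ∨ 2 * clipScale g t ≤ clipScale g (t + 1) := by
  rcases t with _ | t
  · exact Or.inl rfl
  · exact nextScale_eq_or_two_mul_le (clipScale_nonneg g _) _

theorem clipScale_mono : Monotone (clipScale g) := by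
  refine monotone_nat_of_le_succ fun t => ?_
  have := clipScale_nonneg g t
  rcases clipScale_eq_or_two_mul_le g t with h | h <;> linarith

theorem clipScale_pos (h1 : g 1 ≠ 0) (t : ℕ) : 0 < clipScale g t :=
  (norm_pos_iff.2 h1).trans_le (clipScale_mono g (Nat.zero_le t))

theorem clipScale_eq_zero (h1 : g 1 = 0) (t : ℕ) : clipScale g t = 0 := by
  induction t using Nat.strong_induction_on with
  | _ t ih =>
    match t with
    | 0 => simp [clipScale, h1]
    | 1 => simp [clipScale, h1]
    | t + 2 => rw [clipScale, ih (t + 1) (by omega), nextScale_zero]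

theorem norm_le_two_mul_clipScale (h1 : g 1 ≠ 0) {t : ℕ} (ht : 1 ≤ t) :
    ‖g t‖ ≤ 2 * clipScale g (t + 1) := by
  obtain ⟨t, rfl⟩ := Nat.exists_eq_add_of_le' ht
  exact le_two_mul_nextScale (clipScale_pos g h1 _) _

theorem runningMax_mono : Monotone (runningMax g) :=
  monotone_nat_of_le_succ fun _ => le_max_left _ _

theorem runningMax_nonneg (t : ℕ) : 0 ≤ runningMax g t := runningMax_mono g (Nat.zero_le t)

theorem runningMax_le {K : ℝ} (hK : 0 ≤ K) {t : ℕ} (h : ∀ s ∈ Finset.Icc 1 t, ‖g s‖ ≤ K) :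
    runningMax g t ≤ K := by
  induction t with
  | zero => exact hK
  | succ t ih =>
    refine max_le (ih fun s hs => h s ?_) (h _ (by simp))
    rw [Finset.mem_Icc] at hs ⊢
    omega

/-- The scale of round `t + 1` depends only on gradients up to round `t`, hence the shift of index.
It lets the term `(U^(t-1))²` in the learning rate dominate the square of the current scale. -/
theorem clipScale_le_runningMax {t : ℕ} (ht : 1 ≤ t) : clipScale g (t + 1) ≤ runningMax g t := by
  have aux : ∀ t, clipScale g (t + 1) ≤ runningMax g (t + 1) := by
    intro t
    induction t with
    | zero => exact le_max_right _ _
    | succ t ih =>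
      refine (nextScale_le_max _ _).trans (max_le (ih.trans (le_max_left _ _)) ?_)
      exact (le_max_right _ _).trans (le_max_left _ _)
  obtain ⟨t, rfl⟩ := Nat.exists_eq_add_of_le' ht
  refine (nextScale_le_max _ _).trans (max_le (aux t) (le_max_right _ _))

theorem clipScale_two : clipScale g 2 = clipScale g 1 := by
  refine le_antisymm ((clipScale_le_runningMax g le_rfl).trans ?_) (clipScale_mono g one_le_two)
  exact max_le (norm_nonneg _) le_rfl

theorem clip_ratio_nonneg (t : ℕ) : 0 ≤ clipScale g t / clipScale g (t + 1) :=
  div_nonneg (clipScale_nonneg g _) (clipScale_nonneg g _)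

theorem clip_ratio_le_one (t : ℕ) : clipScale g t / clipScale g (t + 1) ≤ 1 :=
  div_le_one_of_le₀ (clipScale_mono g (Nat.le_succ t)) (clipScale_nonneg g _)

theorem norm_clippedGradient_le (t : ℕ) (i : Fin n) : ‖clippedGradient g t i‖ ≤ ‖g t i‖ := by
  unfold clippedGradient
  rw [norm_smul, Real.norm_eq_abs, abs_of_nonneg (clip_ratio_nonneg g t)]
  exact mul_le_of_le_one_left (norm_nonneg _) (clip_ratio_le_one g t)

theorem clippedGradient_zero (h0 : g 0 = 0) : clippedGradient g 0 = 0 := by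
  funext i
  simp [clippedGradient, h0]

theorem norm_clippedGradient_le_two_mul (h1 : g 1 ≠ 0) {t : ℕ} (ht : 1 ≤ t) (i : Fin n) :
    ‖clippedGradient g t i‖ ≤ 2 * clipScale g t := by
  unfold clippedGradient
  rw [norm_smul, Real.norm_eq_abs, abs_of_nonneg (clip_ratio_nonneg g t)]
  have hpos := clipScale_pos g h1 (t + 1)
  have h := (norm_le_pi_norm (g t) i).trans (norm_le_two_mul_clipScale g h1 ht)
  calc clipScale g t / clipScale g (t + 1) * ‖g t i‖
      ≤ clipScale g t / clipScale g (t + 1) * (2 * clipScale g (t + 1)) :=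
        mul_le_mul_of_nonneg_left h (clip_ratio_nonneg g t)
    _ = 2 * clipScale g t := by field_simp

/-- The bound is an increment of the scale, so the clipping errors of all rounds telescope. -/
theorem norm_sub_clippedGradient_le (h1 : g 1 ≠ 0) {t : ℕ} (ht : 1 ≤ t) (i : Fin n) :
    ‖g t i - clippedGradient g t i‖ ≤ 2 * (clipScale g (t + 1) - clipScale g t) := by
  have e : g t i - clippedGradient g t i
      = (1 - clipScale g t / clipScale g (t + 1)) • g t i := by
    unfold clippedGradient; rw [sub_smul, one_smul]
  have hr : 0 ≤ 1 - clipScale g t / clipScale g (t + 1) := by linarith [clip_ratio_le_one g t]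
  rw [e, norm_smul, Real.norm_eq_abs, abs_of_nonneg hr]
  have hpos := clipScale_pos g h1 (t + 1)
  have h := (norm_le_pi_norm (g t) i).trans (norm_le_two_mul_clipScale g h1 ht)
  calc (1 - clipScale g t / clipScale g (t + 1)) * ‖g t i‖
      ≤ (1 - clipScale g t / clipScale g (t + 1)) * (2 * clipScale g (t + 1)) :=
        mul_le_mul_of_nonneg_left h hr
    _ = 2 * (clipScale g (t + 1) - clipScale g t) := by field_simp

/-- The clipping scale is constant around round `t ≥ 3`. -/
def IsSteady (t : ℕ) : Prop := 3 ≤ t ∧ clipScale g (t + 1) = clipScale g (t - 1)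

variable {g} in
theorem IsSteady.clipScale_eq {t : ℕ} (ht : IsSteady g t) :
    clipScale g (t - 1) = clipScale g t ∧ clipScale g (t + 1) = clipScale g t := by
  have h1 := clipScale_mono g (Nat.sub_le t 1)
  have h2 := clipScale_mono g (Nat.le_succ t)
  have h3 := ht.2
  simp only [Nat.succ_eq_add_one] at h2
  constructor <;> linarith

variable {g} in
theorem IsSteady.clippedGradient_eq (h1 : g 1 ≠ 0) {t : ℕ} (ht : IsSteady g t) :
    clippedGradient g t = g t ∧ clippedGradient g (t - 1) = g (t - 1) := by
  obtain ⟨e1, e2⟩ := ht.clipScale_eq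
  have h3 : t - 1 + 1 = t := by have := ht.1; omega
  constructor
  · funext i
    unfold clippedGradient
    rw [e2, div_self (clipScale_pos g h1 t).ne', one_smul]
  · funext i
    unfold clippedGradient
    rw [h3, e1, div_self (clipScale_pos g h1 t).ne', one_smul]

open Classical in
/-- The clipping scales in the rounds that are not steady add up to a multiple of the last one. -/
theorem sum_clipScale_not_steady_le (N : ℕ) :
    ∑ t ∈ Finset.range N, (if IsSteady g (t + 1) then 0 else clipScale g (t + 2))
      ≤ 6 * clipScale g (N + 1) := by
  -- Induction with a potential that remembers two scales: a doubling spoils steadiness for two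
  -- consecutive rounds, and it raises the potential by enough in each of them.
  have aux : ∀ N, ∑ t ∈ Finset.range N, (if IsSteady g (t + 1) then 0 else clipScale g (t + 2))
      ≤ 2 * clipScale g (N + 1) + 2 * (clipScale g (N + 1) + clipScale g N) := by
    intro N
    induction N with
    | zero =>
      have := clipScale_nonneg g 0
      have := clipScale_nonneg g 1
      simp; linarith
    | succ N ih =>
      rw [Finset.sum_range_succ]
      have m1 := clipScale_mono g (Nat.le_succ N)
      have m2 := clipScale_mono g (Nat.le_succ (N + 1))
      have p0 := clipScale_nonneg g N
      simp only [Nat.succ_eq_add_one] at m1 m2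
      have e : N + 1 + 1 = N + 2 := rfl
      rw [e] at *
      -- Rounds `1` and `2` are never steady, whatever the scales do; the initial value of the
      -- potential pays for them.
      rcases Nat.lt_or_ge N 2 with hN | hN
      · interval_cases N
        · simp only [Finset.range_zero, Finset.sum_empty]
          split_ifs <;> linarith
        · have h01 : clipScale g 0 = clipScale g 1 := rfl
          have h21 := clipScale_two g
          norm_num [Finset.sum_range_succ] at ih ⊢
          split_ifs <;> linarith
      · split_ifs with hs
        · linarith
        · have hne : clipScale g (N + 2) ≠ clipScale g N := fun h => hs ⟨by omega, h⟩
          rcases clipScale_eq_or_two_mul_le g N with h | h <;>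
          rcases clipScale_eq_or_two_mul_le g (N + 1) with h' | h' <;>
          rw [e] at h'
          · exact absurd (h'.trans h) hne
          all_goals linarith
  have m1 := clipScale_mono g (Nat.le_succ N)
  simp only [Nat.succ_eq_add_one] at m1
  linarith [aux N]

end Clip

/-! ### Sums of increments against the square root of the partial sums -/

/-- With `α`, `β` the square roots of consecutive partial sums, `δ = (β - α)(β + α) ≤ 2 β (β - α) ≤
4 ρ (β - α)`, which telescopes. -/
theorem sum_div_le_sqrt_sum {δ ρ : ℕ → ℝ} (N : ℕ) (hδ : ∀ t < N, 0 ≤ δ t)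
    (hρ : ∀ t < N, δ t ≠ 0 → √(∑ s ∈ Finset.range (t + 1), δ s) ≤ 2 * ρ t) :
    ∑ t ∈ Finset.range N, δ t / ρ t ≤ 4 * √(∑ t ∈ Finset.range N, δ t) := by
  induction N with
  | zero => simp
  | succ N ih =>
    have ih := ih (fun t ht => hδ t (by omega)) (fun t ht => hρ t (by omega))
    have h0 : 0 ≤ ∑ t ∈ Finset.range N, δ t :=
      Finset.sum_nonneg fun t ht => hδ t (by have := Finset.mem_range.1 ht; omega)
    have hN := hδ N (by omega)
    rcases hN.eq_or_lt with h | h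
    · rw [Finset.sum_range_succ, Finset.sum_range_succ, ← h]; simpa using ih
    · have hr := hρ N (by omega) h.ne'
      rw [Finset.sum_range_succ]
      set α := √(∑ t ∈ Finset.range N, δ t) with hα
      set β := √(∑ t ∈ Finset.range (N + 1), δ t) with hβ
      have hα2 : α ^ 2 = ∑ t ∈ Finset.range N, δ t := Real.sq_sqrt h0
      have hβ2 : β ^ 2 = ∑ t ∈ Finset.range N, δ t + δ N := by
        rw [hβ, Finset.sum_range_succ, Real.sq_sqrt (by linarith)]
      have hβ0 : 0 < β := Real.sqrt_pos.2 (by rw [Finset.sum_range_succ]; linarith)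
      have hα0 : 0 ≤ α := Real.sqrt_nonneg _
      have hαβ : α ≤ β := by nlinarith
      have : δ N / ρ N ≤ 4 * (β - α) := by
        rw [div_le_iff₀ (by linarith)]
        nlinarith [mul_nonneg (sub_nonneg.2 hαβ) hα0, mul_nonneg (sub_nonneg.2 hαβ) (sub_nonneg.2 hr)]
      linarith

/-- A counterpart of the previous estimate, with multiplication by `ρ`. It telescopes because `(3/2)
β (β² - α²) - (β³ - α³) = (1/2)(β - α)² (β + 2α) ≥ 0`. -/
theorem sqrt_sum_pow_three_le {δ ρ : ℕ → ℝ} (N : ℕ) (hδ : ∀ t < N, 0 ≤ δ t)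
    (hρ : ∀ t < N, δ t ≠ 0 → √(∑ s ∈ Finset.range (t + 1), δ s) ≤ 2 * ρ t) :
    √(∑ t ∈ Finset.range N, δ t) ^ 3 ≤ 3 * ∑ t ∈ Finset.range N, ρ t * δ t := by
  induction N with
  | zero => simp
  | succ N ih =>
    have ih := ih (fun t ht => hδ t (by omega)) (fun t ht => hρ t (by omega))
    have h0 : 0 ≤ ∑ t ∈ Finset.range N, δ t :=
      Finset.sum_nonneg fun t ht => hδ t (by have := Finset.mem_range.1 ht; omega)
    have hN := hδ N (by omega)
    rcases hN.eq_or_lt with h | h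
    · rw [Finset.sum_range_succ, Finset.sum_range_succ, ← h]; simpa using ih
    · have hr := hρ N (by omega) h.ne'
      rw [Finset.sum_range_succ (fun t => ρ t * δ t)]
      set α := √(∑ t ∈ Finset.range N, δ t) with hα
      set β := √(∑ t ∈ Finset.range (N + 1), δ t) with hβ
      have hα2 : α ^ 2 = ∑ t ∈ Finset.range N, δ t := Real.sq_sqrt h0
      have hβ2 : β ^ 2 = ∑ t ∈ Finset.range N, δ t + δ N := by
        rw [hβ, Finset.sum_range_succ, Real.sq_sqrt (by linarith)]
      have hβ0 : 0 ≤ β := Real.sqrt_nonneg _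
      have hα0 : 0 ≤ α := Real.sqrt_nonneg _
      have h1 : β / 2 * δ N ≤ ρ N * δ N := by gcongr; linarith
      have h2 : δ N = β ^ 2 - α ^ 2 := by linarith
      have h3 : 0 ≤ (β - α) ^ 2 * (β + 2 * α) := by positivity
      rw [h2] at h1
      rw [h2]
      nlinarith

/-! ### Expected utilities -/

section Game

variable {n : ℕ} {A : Fin n → Type*} [∀ i, Fintype (A i)]

/-- The expectation of `f` under the product of the measures `p j`. -/
def productExpectation (f : (∀ j, A j) → ℝ) (p : ∀ j, A j → ℝ) : ℝ :=
  ∑ b : (∀ j, A j), (∏ j, p j (b j)) * f b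

theorem sum_prod_apply (p : ∀ j, A j → ℝ) :
    ∑ b : (∀ j, A j), ∏ j, p j (b j) = ∏ j, ∑ k, p j k := by
  rw [Finset.prod_univ_sum, Fintype.piFinset_univ]

theorem abs_productExpectation_le {f : (∀ j, A j) → ℝ} {U : ℝ} (hf : ∀ b, |f b| ≤ U)
    (p : ∀ j, A j → ℝ) : |productExpectation f p| ≤ U * ∏ j, ∑ k, |p j k| := by
  unfold productExpectation
  rw [← sum_prod_apply (fun j k => |p j k|), Finset.mul_sum]
  refine (Finset.abs_sum_le_sum_abs _ _).trans (Finset.sum_le_sum fun b _ => ?_)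
  rw [abs_mul, Finset.abs_prod, mul_comm]
  exact mul_le_mul_of_nonneg_right (hf b) (Finset.prod_nonneg fun _ _ => abs_nonneg _)

theorem sum_abs_of_mem_stdSimplex {α : Type*} [Fintype α] {p : α → ℝ} (hp : p ∈ stdSimplex ℝ α) :
    ∑ k, |p k| = 1 := by
  rw [← hp.2]; exact Finset.sum_congr rfl fun k _ => abs_of_nonneg (hp.1 k)

theorem productExpectation_sub_update (f : (∀ j, A j) → ℝ) (p : ∀ j, A j → ℝ) (i : Fin n)
    (q : A i → ℝ) : productExpectation f p - productExpectation f (Function.update p i q)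
      = productExpectation f (Function.update p i (p i - q)) := by
  unfold productExpectation
  rw [← Finset.sum_sub_distrib]
  refine Finset.sum_congr rfl fun b _ => ?_
  have e : ∀ r : A i → ℝ, ∏ j, Function.update p i r j (b j)
      = r (b i) * ∏ j ∈ Finset.univ.erase i, p j (b j) := by
    intro r
    rw [← Finset.mul_prod_erase _ _ (Finset.mem_univ i), Function.update_self]
    congr 1
    refine Finset.prod_congr rfl fun j hj => ?_
    rw [Function.update_of_ne (Finset.ne_of_mem_erase hj)]
  rw [e, e, ← Finset.mul_prod_erase _ _ (Finset.mem_univ i), Pi.sub_apply]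
  ring

/-- The expectation is multilinear in the strategies, so they are exchanged one player at a time,
each exchange costing one `ℓ¹` distance. -/
theorem abs_productExpectation_sub_le {f : (∀ j, A j) → ℝ} {U : ℝ} (hf : ∀ b, |f b| ≤ U)
    {p q : ∀ j, A j → ℝ} (hp : ∀ j, p j ∈ stdSimplex ℝ (A j))
    (hq : ∀ j, q j ∈ stdSimplex ℝ (A j)) :
    |productExpectation f p - productExpectation f q| ≤ U * ∑ j, ∑ k, |p j k - q j k| := by
  suffices H : ∀ s : Finset (Fin n), |productExpectation f p
      - productExpectation f (fun j => if j ∈ s then q j else p j)|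
        ≤ U * ∑ j ∈ s, ∑ k, |p j k - q j k| by
    simpa using H Finset.univ
  intro s
  induction s using Finset.induction_on with
  | empty => simp
  | insert i s hi ih =>
    set r : ∀ j, A j → ℝ := fun j => if j ∈ s then q j else p j with hr
    have e : (fun j => if j ∈ insert i s then q j else p j) = Function.update r i (q i) := by
      funext j
      by_cases hj : j = i
      · subst hj; simp
      · simp [hr, hj]
    have hri : r i = p i := by simp [hr, hi]
    have h1 : |productExpectation f r - productExpectation f (Function.update r i (q i))|
        ≤ U * ∑ k, |p i k - q i k| := by
      rw [productExpectation_sub_update]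
      refine (abs_productExpectation_le hf _).trans_eq ?_
      rw [← Finset.mul_prod_erase _ _ (Finset.mem_univ i), Function.update_self,
        Finset.prod_eq_one, mul_one, hri]
      · rfl
      · intro j hj
        rw [Function.update_of_ne (Finset.ne_of_mem_erase hj), hr]
        dsimp only
        split_ifs
        · exact sum_abs_of_mem_stdSimplex (hq j)
        · exact sum_abs_of_mem_stdSimplex (hp j)
    rw [e, Finset.sum_insert hi, mul_add]
    have := abs_sub_le (productExpectation f p) (productExpectation f r)
      (productExpectation f (Function.update r i (q i)))
    linarith

theorem averagePlay_sum (x : ℕ → ∀ i, A i → ℝ) (T : ℕ) (f : (∀ j, A j) → ℝ) :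
    ∑ b, averagePlay x T b * f b
      = 1 / T * ∑ t ∈ Finset.Icc 1 T, ∑ b : (∀ j, A j), (∏ j, x t j (b j)) * f b := by
  unfold averagePlay
  rw [Finset.sum_comm, Finset.mul_sum]
  refine Finset.sum_congr rfl fun b _ => ?_
  rw [mul_assoc, Finset.sum_mul]

variable [∀ i, DecidableEq (A i)] (u : Fin n → (∀ j, A j) → ℝ)

theorem expectedUtility_eq (p : ∀ j, A j → ℝ) (i : Fin n) (a : A i) :
    expectedUtility u p i a
      = productExpectation (u i) (Function.update p i (Pi.single a 1)) := by
  unfold expectedUtility productExpectation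
  rw [Finset.sum_filter]
  refine Finset.sum_congr rfl fun b _ => ?_
  rw [← Finset.mul_prod_erase _ _ (Finset.mem_univ i), Function.update_self]
  have e : ∏ j ∈ Finset.univ.erase i, Function.update p i (Pi.single a 1) j (b j)
      = ∏ j ∈ Finset.univ.erase i, p j (b j) := by
    refine Finset.prod_congr rfl fun j hj => ?_
    rw [Function.update_of_ne (Finset.ne_of_mem_erase hj)]
  rw [e, Pi.single_apply]
  split_ifs <;> simp

theorem update_single_mem {p : ∀ j, A j → ℝ} (hp : ∀ j, p j ∈ stdSimplex ℝ (A j)) (i : Fin n)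
    (a : A i) (j : Fin n) : Function.update p i (Pi.single a 1) j ∈ stdSimplex ℝ (A j) := by
  by_cases hj : j = i
  · subst hj
    rw [Function.update_self]
    exact single_mem_stdSimplex ℝ a
  · rw [Function.update_of_ne hj]
    exact hp j

variable {u} in
theorem abs_expectedUtility_le {U : ℝ} (hu : ∀ i b, |u i b| ≤ U) {p : ∀ j, A j → ℝ} (hp : ∀ j, p j ∈ stdSimplex ℝ (A j)) (i : Fin n)
    (a : A i) : |expectedUtility u p i a| ≤ U := by
  rw [expectedUtility_eq]
  refine (abs_productExpectation_le (hu i) _).trans_eq ?_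
  rw [Finset.prod_eq_one, mul_one]
  exact fun j _ => sum_abs_of_mem_stdSimplex (update_single_mem hp i a j)

variable {u} in
theorem abs_expectedUtility_sub_le {U : ℝ} (hu : ∀ i b, |u i b| ≤ U) {p q : ∀ j, A j → ℝ} (hp : ∀ j, p j ∈ stdSimplex ℝ (A j))
    (hq : ∀ j, q j ∈ stdSimplex ℝ (A j)) (i : Fin n) (a : A i) :
    |expectedUtility u p i a - expectedUtility u q i a| ≤ U * ∑ j, ∑ k, |p j k - q j k| := by
  rw [expectedUtility_eq, expectedUtility_eq]
  have hU : 0 ≤ U := (abs_nonneg _).trans (abs_expectedUtility_le hu hp i a)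
  refine (abs_productExpectation_sub_le (hu i) (update_single_mem hp i a)
    (update_single_mem hq i a)).trans ?_
  refine mul_le_mul_of_nonneg_left (Finset.sum_le_sum fun j _ => ?_) hU
  by_cases hj : j = i
  · subst hj
    simp only [Function.update_self, sub_self, abs_zero, Finset.sum_const_zero]
    exact Finset.sum_nonneg fun _ _ => abs_nonneg _
  · rw [Function.update_of_ne hj, Function.update_of_ne hj]

/-- Group the profiles by the action `a` that is drawn for player `i`; overwriting that coordinate
by `φ a` is a bijection between fibres and leaves the opponents' weights unchanged. -/
theorem sum_prod_mul_update (p : ∀ j, A j → ℝ) (i : Fin n) (φ : A i → A i) :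
    ∑ b : (∀ j, A j), (∏ j, p j (b j)) * u i (Function.update b i (φ (b i)))
      = ∑ a, p i a * expectedUtility u p i (φ a) := by
  rw [← Finset.sum_fiberwise (s := Finset.univ) (g := fun b : (∀ j, A j) => b i)]
  refine Finset.sum_congr rfl fun a _ => ?_
  unfold expectedUtility
  rw [Finset.mul_sum]
  have e : ∀ (b : ∀ j, A j) (c : A i), ∏ j ∈ Finset.univ.erase i, p j (Function.update b i c j)
      = ∏ j ∈ Finset.univ.erase i, p j (b j) := by
    intro b c
    refine Finset.prod_congr rfl fun j hj => ?_
    rw [Function.update_of_ne (Finset.ne_of_mem_erase hj)]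
  refine Finset.sum_bij' (fun b _ => Function.update b i (φ a)) (fun b _ => Function.update b i a)
    ?_ ?_ ?_ ?_ ?_
  · intro b _; simp
  · intro b _; simp
  · intro b hb
    have : b i = a := by simpa using hb
    subst this; simp
  · intro b hb
    have : b i = φ a := by simpa using hb
    rw [Function.update_idem, ← this, Function.update_eq_self]
  · intro b hb
    have : b i = a := by simpa using hb
    subst this
    rw [e, ← Finset.mul_prod_erase _ _ (Finset.mem_univ i)]
    ring

theorem sum_prod_mul (p : ∀ j, A j → ℝ) (i : Fin n) :
    ∑ b : (∀ j, A j), (∏ j, p j (b j)) * u i b = ∑ a, p i a * expectedUtility u p i a := by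
  have := sum_prod_mul_update u p i id
  simpa using this

/-- Small swap regrets make the time-averaged play an approximate correlated equilibrium. -/
theorem isApproxCorrelatedEquilibrium_averagePlay {x : ℕ → ∀ i, A i → ℝ} {T : ℕ} (hT : 1 ≤ T)
    (hx : ∀ t ∈ Finset.Icc 1 T, ∀ i, x t i ∈ stdSimplex ℝ (A i)) {R : ℝ}
    (hR : ∀ i, swapRegret (fun t => x t i) (fun t => gradient u x t i) T ≤ R) :
    IsApproxCorrelatedEquilibrium u (R / T) (averagePlay x T) := by
  have hT0 : (0 : ℝ) < T := by exact_mod_cast hT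
  refine ⟨⟨fun b => ?_, ?_⟩, fun i φ => ?_⟩
  · exact mul_nonneg (by positivity) (Finset.sum_nonneg fun t ht =>
      Finset.prod_nonneg fun j _ => (hx t ht j).1 _)
  · have h := averagePlay_sum x T (fun _ => (1 : ℝ))
    simp only [mul_one] at h
    rw [h, Finset.sum_congr rfl fun t ht => (sum_prod_apply (x t)).trans
      (Finset.prod_eq_one fun j _ => (hx t ht j).2)]
    simp [hT0.ne']
  -- A deviation map is the row-stochastic matrix with rows the point masses at `φ a`.
  · set M : Matrix (A i) (A i) ℝ := Matrix.of fun a => Pi.single (φ a) 1 with hM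
    have hMmem : M ∈ Matrix.rowStochastic ℝ (A i) := by
      rw [Matrix.mem_rowStochastic_iff_sum]
      exact ⟨fun a k => (single_mem_stdSimplex ℝ (φ a)).1 k,
        fun a => (single_mem_stdSimplex ℝ (φ a)).2⟩
    have h1 := (swapRegret_isGreatest (fun t => x t i) (fun t => gradient u x t i) T).2
      (Set.mem_image_of_mem _ hMmem)
    have h2 : swapRegretAgainst (fun t => x t i) (fun t => gradient u x t i) T M
        = ∑ t ∈ Finset.Icc 1 T, ((∑ a, x t i a * expectedUtility u (x t) i (φ a))
          - ∑ a, x t i a * expectedUtility u (x t) i a) := by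
      unfold swapRegretAgainst
      refine Finset.sum_congr rfl fun t ht => ?_
      have ht1 : t ≠ 0 := by have := (Finset.mem_Icc.1 ht).1; omega
      rw [dotProduct_sub]
      congr 1
      · refine Finset.sum_congr rfl fun a _ => ?_
        simp [hM, gradient, ht1, Matrix.mulVec]
      · simp [gradient, ht1, dotProduct]
    rw [averagePlay_sum x T (fun b => u i (Function.update b i (φ (b i)))),
      averagePlay_sum x T (fun b => u i b)]
    simp only [sum_prod_mul_update, sum_prod_mul]
    rw [Finset.sum_sub_distrib] at h2
    have h3 := h1.trans (hR i)
    rw [h2] at h3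
    have h4 := div_le_div_of_nonneg_right h3 hT0.le
    rw [sub_div] at h4
    rw [one_div, inv_mul_eq_div, inv_mul_eq_div]
    linarith

end Game

/-! ### Path lengths and learning rates -/

section Rates

variable {n : ℕ} {A : Fin n → Type*} [∀ i, Fintype (A i)] {g v : ℕ → ∀ i, A i → ℝ}

/-- The squared movement from round `t` to round `t + 1`, summed over the players. -/
def stepSq (v : ℕ → ∀ i, A i → ℝ) (t : ℕ) : ℝ := ∑ j, ‖v (t + 1) j - v t j‖ ^ 2

theorem stepSq_nonneg (v : ℕ → ∀ i, A i → ℝ) (t : ℕ) : 0 ≤ stepSq v t :=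
  Finset.sum_nonneg fun _ _ => sq_nonneg _

open Classical in
/-- The squared movement into the steady rounds. -/
def steadyStepSq (g v : ℕ → ∀ i, A i → ℝ) (t : ℕ) : ℝ :=
  if IsSteady g (t + 1) then stepSq v t else 0

theorem steadyStepSq_nonneg (g v : ℕ → ∀ i, A i → ℝ) (t : ℕ) : 0 ≤ steadyStepSq g v t := by
  unfold steadyStepSq
  split_ifs
  · exact stepSq_nonneg v t
  · exact le_rfl

theorem steadyStepSq_le (g v : ℕ → ∀ i, A i → ℝ) (t : ℕ) : steadyStepSq g v t ≤ stepSq v t := by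
  unfold steadyStepSq
  split_ifs
  · exact le_rfl
  · exact stepSq_nonneg v t

theorem rateDenominator_succ (g v : ℕ → ∀ i, A i → ℝ) (t : ℕ) :
    rateDenominator g v (t + 1)
      = √(8 * n * runningMax g t ^ 2 + ∑ s ∈ Finset.range t, stepSq v s) := by
  unfold rateDenominator pathLength stepSq
  rw [Finset.sum_comm, Nat.add_sub_cancel]

theorem rateDenominator_radicand_nonneg (g v : ℕ → ∀ i, A i → ℝ) (t : ℕ) :
    0 ≤ 8 * n * runningMax g t ^ 2 + ∑ s ∈ Finset.range t, stepSq v s :=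
  add_nonneg (by positivity) (Finset.sum_nonneg fun s _ => stepSq_nonneg v s)

theorem rateDenominator_one (g v : ℕ → ∀ i, A i → ℝ) : rateDenominator g v 1 = 0 := by
  rw [show (1 : ℕ) = 0 + 1 from rfl, rateDenominator_succ]
  simp [runningMax]

theorem rateDenominator_succ_mono (g v : ℕ → ∀ i, A i → ℝ) (t : ℕ) :
    rateDenominator g v (t + 1) ≤ rateDenominator g v (t + 1 + 1) := by
  rw [rateDenominator_succ, rateDenominator_succ, Finset.sum_range_succ]
  apply Real.sqrt_le_sqrt
  have h1 := runningMax_nonneg g t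
  have h2 := runningMax_mono g (Nat.le_succ t)
  have h3 := stepSq_nonneg v t
  simp only [Nat.succ_eq_add_one] at h2
  have : 8 * (n : ℝ) * runningMax g t ^ 2 ≤ 8 * n * runningMax g (t + 1) ^ 2 := by gcongr
  linarith

theorem rateDenominator_pos (hn : 0 < n) (h1 : g 1 ≠ 0) {t : ℕ} (ht : 1 ≤ t) :
    0 < rateDenominator g v (t + 1) := by
  rw [rateDenominator_succ]
  apply Real.sqrt_pos.2
  have hU : 0 < runningMax g t := (clipScale_pos g h1 _).trans_le (clipScale_le_runningMax g ht)
  have hn' : (0 : ℝ) < n := by exact_mod_cast hn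
  have := Finset.sum_nonneg fun s (_ : s ∈ Finset.range t) => stepSq_nonneg v s
  have : 0 < 8 * (n : ℝ) * runningMax g t ^ 2 := by positivity
  linarith

/-- The vector sequences whose path lengths may enter the learning rates. -/
def IsRateSequence (g v : ℕ → ∀ i, A i → ℝ) : Prop := v = clippedGradient g ∨ v = g

theorem IsRateSequence.norm_step_le (hv : IsRateSequence g v) (h0 : g 0 = 0) (h1 : g 1 ≠ 0) (t : ℕ)
    (j : Fin n) : ‖v (t + 1) j - v t j‖ ≤ 4 * clipScale g (t + 2) := by
  have m1 := clipScale_mono g (Nat.le_succ t)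
  have m2 := clipScale_mono g (Nat.le_succ (t + 1))
  have p0 := clipScale_nonneg g t
  simp only [Nat.succ_eq_add_one, add_assoc] at m1 m2
  norm_num at m2
  have hg : ∀ s, 1 ≤ s → ‖g s j‖ ≤ 2 * clipScale g (s + 1) := fun s hs =>
    (norm_le_pi_norm (g s) j).trans (norm_le_two_mul_clipScale g h1 hs)
  have hgt : ‖g t j‖ ≤ 2 * clipScale g (t + 1) := by
    rcases t with _ | t
    · rw [h0]; simpa using clipScale_nonneg g 1
    · exact hg _ (by omega)
  have hg' := hg (t + 1) (by omega)
  have e : t + 1 + 1 = t + 2 := rfl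
  rw [e] at hg'
  refine (norm_sub_le _ _).trans ?_
  rcases hv with rfl | rfl
  · have := norm_clippedGradient_le g (t + 1) j
    have := norm_clippedGradient_le g t j
    linarith
  · linarith

/-- This makes the two versions of the algorithm indistinguishable in steady rounds: clipping acts
as the identity at both ends of the step. -/
theorem IsRateSequence.sub_eq (hv : IsRateSequence g v) (h1 : g 1 ≠ 0) {t : ℕ}
    (ht : IsSteady g (t + 1)) (j : Fin n) : v (t + 1) j - v t j = g (t + 1) j - g t j := by
  obtain ⟨e1, e2⟩ := ht.clippedGradient_eq h1
  rw [Nat.add_sub_cancel] at e2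
  rcases hv with rfl | rfl
  · rw [e1, e2]
  · rfl

theorem IsRateSequence.stepSq_le (hv : IsRateSequence g v) (h0 : g 0 = 0) (h1 : g 1 ≠ 0) (t : ℕ) :
    stepSq v t ≤ 16 * n * clipScale g (t + 2) ^ 2 := by
  unfold stepSq
  calc ∑ j, ‖v (t + 1) j - v t j‖ ^ 2 ≤ ∑ _j : Fin n, (4 * clipScale g (t + 2)) ^ 2 :=
        Finset.sum_le_sum fun j _ =>
          pow_le_pow_left₀ (norm_nonneg _) (hv.norm_step_le h0 h1 t j) 2
    _ = _ := by rw [Finset.sum_const, Finset.card_univ, Fintype.card_fin, nsmul_eq_mul]; ring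

theorem sum_steadyStepSq_le (g v : ℕ → ∀ i, A i → ℝ) (N : ℕ) :
    ∑ t ∈ Finset.range N, steadyStepSq g v t ≤ ∑ t ∈ Finset.range N, stepSq v t :=
  Finset.sum_le_sum fun t _ => steadyStepSq_le g v t

theorem isSteady_of_steadyStepSq_ne_zero {t : ℕ} (h : steadyStepSq g v t ≠ 0) :
    IsSteady g (t + 1) := by
  by_contra hs
  exact h (by simp [steadyStepSq, hs])

/-- The denominator of round `t + 1` lacks the step `t` itself. In a steady round that step is at
most `16 n (U^t)²`, which is covered by the term `8 n (U^t)²` after squaring the factor `2`. -/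
theorem IsRateSequence.sqrt_sum_le_rateDenominator (hv : IsRateSequence g v) (h0 : g 0 = 0)
    (h1 : g 1 ≠ 0) {t : ℕ} (ht : steadyStepSq g v t ≠ 0) :
    √(∑ s ∈ Finset.range (t + 1), steadyStepSq g v s) ≤ 2 * rateDenominator g v (t + 1) := by
  have hs := isSteady_of_steadyStepSq_ne_zero ht
  obtain ⟨e1, e2⟩ := hs.clipScale_eq
  have h3 : 1 ≤ t := by have := hs.1; omega
  rw [rateDenominator_succ, Real.sqrt_le_left (by positivity), mul_pow,
    Real.sq_sqrt (rateDenominator_radicand_nonneg g v t)]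
  have hδ := hv.stepSq_le h0 h1 t
  have e : t + 2 = t + 1 + 1 := rfl
  rw [e, e2] at hδ
  have hB : clipScale g (t + 1) ^ 2 ≤ runningMax g t ^ 2 :=
    pow_le_pow_left₀ (clipScale_nonneg g _) (clipScale_le_runningMax g h3) 2
  have hB' : 16 * (n : ℝ) * clipScale g (t + 1) ^ 2 ≤ 16 * n * runningMax g t ^ 2 := by gcongr
  have hS := sum_steadyStepSq_le g v (t + 1)
  rw [Finset.sum_range_succ (fun s => stepSq v s)] at hS
  have hS0 := Finset.sum_nonneg fun s (_ : s ∈ Finset.range t) => stepSq_nonneg v s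
  have : 0 ≤ (n : ℝ) * runningMax g t ^ 2 := by positivity
  linarith

/-- Now two steps are missing, and `2 · 16 n = 4 · 8 n` uses the constant `8` exactly. Steadiness
involves two consecutive scale changes and rounds from `3` on precisely so that the scale is bounded
by `U^(t-1)` here. The delay is needed because a movement of strategies, weighted with the
denominator of one round, produces a gradient step in the next. -/
theorem IsRateSequence.sqrt_sum_le_rateDenominator_prev (hv : IsRateSequence g v) (h0 : g 0 = 0)
    (h1 : g 1 ≠ 0) {t : ℕ} (ht : steadyStepSq g v t ≠ 0) :
    √(∑ s ∈ Finset.range (t + 1), steadyStepSq g v s) ≤ 2 * rateDenominator g v t := by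
  have hs := isSteady_of_steadyStepSq_ne_zero ht
  obtain ⟨e1, e2⟩ := hs.clipScale_eq
  obtain ⟨t, rfl⟩ : ∃ k, t = k + 2 := ⟨t - 2, by have := hs.1; omega⟩
  have e : t + 2 = t + 1 + 1 := rfl
  rw [e, rateDenominator_succ, Real.sqrt_le_left (by positivity), mul_pow,
    Real.sq_sqrt (rateDenominator_radicand_nonneg g v _)]
  have hδ := hv.stepSq_le h0 h1 (t + 2)
  have hδ' := hv.stepSq_le h0 h1 (t + 1)
  simp only [Nat.add_sub_cancel] at e1
  have e3 : t + 2 + 2 = t + 2 + 1 + 1 := rfl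
  have e4 : t + 1 + 2 = t + 2 + 1 := rfl
  rw [e3, e2, ← e1] at hδ
  rw [e4, ← e1] at hδ'
  have hB : clipScale g (t + 2) ^ 2 ≤ runningMax g (t + 1) ^ 2 :=
    pow_le_pow_left₀ (clipScale_nonneg g _) (clipScale_le_runningMax g (by omega)) 2
  have hB' : 16 * (n : ℝ) * clipScale g (t + 2) ^ 2 ≤ 16 * n * runningMax g (t + 1) ^ 2 := by gcongr
  have hS := sum_steadyStepSq_le g v (t + 1 + 1 + 1)
  rw [Finset.sum_range_succ (fun s => stepSq v s), Finset.sum_range_succ (fun s => stepSq v s)] at hS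
  have hS0 := Finset.sum_nonneg fun s (_ : s ∈ Finset.range (t + 1)) => stepSq_nonneg v s
  have : 0 ≤ (n : ℝ) * runningMax g (t + 1) ^ 2 := by positivity
  linarith

-- A non-steady step is quadratic in the scale. Bounding one factor by `U` leaves the linear sum of
-- scales, so the constant is `96 = 16 · 6`.
open Classical in
theorem IsRateSequence.sum_stepSq_le (hv : IsRateSequence g v) (h0 : g 0 = 0) (h1 : g 1 ≠ 0)
    {U : ℝ} {N : ℕ} (hU : clipScale g (N + 1) ≤ U) :
    ∑ t ∈ Finset.range N, stepSq v t
      ≤ ∑ t ∈ Finset.range N, steadyStepSq g v t + 96 * n * U ^ 2 := by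
  have hU0 : 0 ≤ U := (clipScale_nonneg g _).trans hU
  have hterm : ∀ t ∈ Finset.range N, stepSq v t ≤ steadyStepSq g v t
      + 16 * n * U * (if IsSteady g (t + 1) then 0 else clipScale g (t + 2)) := by
    intro t ht
    unfold steadyStepSq
    split_ifs
    · simp
    · have hB : clipScale g (t + 2) ≤ U :=
        (clipScale_mono g (by have := Finset.mem_range.1 ht; omega)).trans hU
      have hB0 := clipScale_nonneg g (t + 2)
      refine (hv.stepSq_le h0 h1 t).trans ?_
      rw [zero_add, mul_assoc _ U, sq]
      gcongr
  have h2 := Finset.sum_le_sum hterm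
  rw [Finset.sum_add_distrib, ← Finset.mul_sum] at h2
  have h3 := (sum_clipScale_not_steady_le g N).trans (mul_le_mul_of_nonneg_left hU (by norm_num))
  have h4 : 16 * (n : ℝ) * U * ∑ t ∈ Finset.range N,
      (if IsSteady g (t + 1) then 0 else clipScale g (t + 2)) ≤ 16 * n * U * (6 * U) := by gcongr
  linarith

theorem IsRateSequence.rateDenominator_le (hv : IsRateSequence g v) (h0 : g 0 = 0) (h1 : g 1 ≠ 0)
    {U : ℝ} {N : ℕ} (hU : clipScale g (N + 1) ≤ U) (hmax : runningMax g N ≤ U) :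
    rateDenominator g v (N + 1)
      ≤ 11 * √n * U + √(∑ t ∈ Finset.range N, steadyStepSq g v t) := by
  have hU0 : 0 ≤ U := (clipScale_nonneg g _).trans hU
  have hW := Finset.sum_nonneg fun t (_ : t ∈ Finset.range N) => steadyStepSq_nonneg g v t
  -- The constant `11` is admissible because `8 + 96 ≤ 11²`.
  rw [rateDenominator_succ, Real.sqrt_le_left (by positivity)]
  have h2 := hv.sum_stepSq_le h0 h1 hU
  have h3 : 8 * (n : ℝ) * runningMax g N ^ 2 ≤ 8 * n * U ^ 2 := by
    have := runningMax_nonneg g N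
    gcongr
  have h4 : (11 * √n * U + √(∑ t ∈ Finset.range N, steadyStepSq g v t)) ^ 2
      = 121 * (√n ^ 2 * U ^ 2) + 22 * (√n * U * √(∑ t ∈ Finset.range N, steadyStepSq g v t))
        + √(∑ t ∈ Finset.range N, steadyStepSq g v t) ^ 2 := by ring
  rw [h4, Real.sq_sqrt hW, Real.sq_sqrt (Nat.cast_nonneg n)]
  have : 0 ≤ √(n : ℝ) * U * √(∑ t ∈ Finset.range N, steadyStepSq g v t) := by positivity
  have : 0 ≤ (n : ℝ) * U ^ 2 := by positivity
  linarith

/-- The learning rate of round `t + 1`, with a harmless positive value in the first round. -/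
def effectiveRate (T : ℕ) (g v : ℕ → ∀ i, A i → ℝ) (i : Fin n) (t : ℕ) : ℝ :=
  if t = 0 then 1 / (256 * √(Fintype.card (A i) : ℝ)) / clipScale g 1
  else learningRate T g v i (t + 1)

variable {T : ℕ} {i : Fin n}

theorem effectiveRate_le_clip (t : ℕ) :
    effectiveRate T g v i t ≤ 1 / (256 * √(Fintype.card (A i) : ℝ)) / clipScale g (t + 1) := by
  unfold effectiveRate
  split_ifs with h
  · rw [h]
  · exact min_le_right _ _

theorem effectiveRate_le_path {t : ℕ} (ht : 1 ≤ t) : effectiveRate T g v i t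
    ≤ Fintype.card (A i) * √(Real.log T) / rateDenominator g v (t + 1) := by
  unfold effectiveRate
  rw [if_neg (by omega)]
  exact min_le_left _ _

theorem log_pos_of_two_le (hT : 2 ≤ T) : 0 < Real.log T :=
  Real.log_pos (by exact_mod_cast hT)

theorem effectiveRate_pos (hT : 2 ≤ T) [Nonempty (A i)] (hn : 0 < n) (h1 : g 1 ≠ 0) (t : ℕ) :
    0 < effectiveRate T g v i t := by
  have hm : (0 : ℝ) < Fintype.card (A i) := by exact_mod_cast Fintype.card_pos
  have hB := clipScale_pos g h1
  unfold effectiveRate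
  split_ifs with h
  · have := hB 1
    positivity
  · have := hB (t + 1)
    have := rateDenominator_pos (v := v) hn h1 (t := t) (by omega)
    have := log_pos_of_two_le hT
    exact lt_min (by positivity) (by positivity)

theorem effectiveRate_anti [Nonempty (A i)] (hn : 0 < n) (h1 : g 1 ≠ 0) (t : ℕ) :
    effectiveRate T g v i (t + 1) ≤ effectiveRate T g v i t := by
  have hm : (0 : ℝ) < Fintype.card (A i) := by exact_mod_cast Fintype.card_pos
  have hclip : 1 / (256 * √(Fintype.card (A i) : ℝ)) / clipScale g (t + 1 + 1)
      ≤ 1 / (256 * √(Fintype.card (A i) : ℝ)) / clipScale g (t + 1) := by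
    have := clipScale_pos g h1 (t + 1)
    have := clipScale_mono g (Nat.le_succ (t + 1))
    gcongr
  rcases Nat.eq_zero_or_pos t with rfl | ht
  · refine (effectiveRate_le_clip _).trans (hclip.trans_eq ?_)
    simp [effectiveRate]
  · unfold effectiveRate
    rw [if_neg (by omega), if_neg (by omega)]
    refine min_le_min ?_ hclip
    have := rateDenominator_pos (v := v) hn h1 ht
    have := rateDenominator_succ_mono g v t
    gcongr

theorem effectiveRate_mul_norm_le [Nonempty (A i)] (h1 : g 1 ≠ 0) (t : ℕ) :
    effectiveRate T g v i t * ‖clippedGradient g (t + 1) i‖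
      ≤ 1 / (128 * √(Fintype.card (A i) : ℝ)) := by
  have hm : (0 : ℝ) < Fintype.card (A i) := by exact_mod_cast Fintype.card_pos
  have hB := clipScale_pos g h1 (t + 1)
  calc effectiveRate T g v i t * ‖clippedGradient g (t + 1) i‖
      ≤ 1 / (256 * √(Fintype.card (A i) : ℝ)) / clipScale g (t + 1) * (2 * clipScale g (t + 1)) := by
        apply mul_le_mul (effectiveRate_le_clip t)
          (norm_clippedGradient_le_two_mul g h1 (by omega) i) (norm_nonneg _) (by positivity)
    _ = _ := by field_simp; norm_num

/-- Used to turn the weights `1 / η` of the negative movement terms into denominators common to all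
players. In the first round the denominator is zero, so the substitute rate does no harm. -/
theorem rateDenominator_le_inv_effectiveRate (hT : 2 ≤ T) [Nonempty (A i)] (hn : 0 < n)
    (h1 : g 1 ≠ 0) (t : ℕ) : rateDenominator g v (t + 1)
      ≤ Fintype.card (A i) * √(Real.log T) / effectiveRate T g v i t := by
  have hη := effectiveRate_pos (v := v) (i := i) hT hn h1 t
  rcases Nat.eq_zero_or_pos t with rfl | ht
  · rw [zero_add, rateDenominator_one]; positivity
  · rw [le_div_iff₀ hη, mul_comm, ← le_div_iff₀ (rateDenominator_pos hn h1 ht)]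
    exact effectiveRate_le_path ht

theorem inv_effectiveRate_le (hT : 2 ≤ T) [Nonempty (A i)] (hn : 0 < n) (h1 : g 1 ≠ 0)
    {t : ℕ} (ht : 1 ≤ t) : 1 / effectiveRate T g v i t
      ≤ 256 * √(Fintype.card (A i) : ℝ) * clipScale g (t + 1)
        + rateDenominator g v (t + 1) / (Fintype.card (A i) * √(Real.log T)) := by
  have hm : (0 : ℝ) < Fintype.card (A i) := by exact_mod_cast Fintype.card_pos
  have hB := clipScale_pos g h1 (t + 1)
  have hR := rateDenominator_pos (v := v) hn h1 ht
  have hL := log_pos_of_two_le hT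
  unfold effectiveRate learningRate
  rw [if_neg (by omega)]
  rcases min_choice (Fintype.card (A i) * √(Real.log T) / rateDenominator g v (t + 1))
    (1 / (256 * √(Fintype.card (A i) : ℝ)) / clipScale g (t + 1)) with h | h <;> rw [h]
  · rw [one_div_div]
    have : 0 ≤ 256 * √(Fintype.card (A i) : ℝ) * clipScale g (t + 1) := by positivity
    linarith
  · rw [div_div, one_div_one_div]
    have : 0 ≤ rateDenominator g v (t + 1) / (Fintype.card (A i) * √(Real.log T)) := by positivity
    linarith

open Classical in
/-- The stability terms of one player. -/
theorem IsRateSequence.sum_effectiveRate_mul_le (hv : IsRateSequence g v) (h0 : g 0 = 0)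
    (h1 : g 1 ≠ 0) [Nonempty (A i)] (hn : 0 < n) {U : ℝ} {N : ℕ}
    (hU : clipScale g (N + 1) ≤ U) :
    ∑ t ∈ Finset.range N,
        effectiveRate T g v i t * ‖clippedGradient g (t + 1) i - clippedGradient g t i‖ ^ 2 ≤
      4 * (Fintype.card (A i) * √(Real.log T)) * √(∑ t ∈ Finset.range N, steadyStepSq g v t)
        + 3 / 8 * U := by
  have hm : (1 : ℝ) ≤ Fintype.card (A i) := by exact_mod_cast Fintype.card_pos
  have hterm : ∀ t ∈ Finset.range N,
      effectiveRate T g v i t * ‖clippedGradient g (t + 1) i - clippedGradient g t i‖ ^ 2 ≤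
      Fintype.card (A i) * √(Real.log T) * (steadyStepSq g v t / rateDenominator g v (t + 1))
        + 1 / 16 * (if IsSteady g (t + 1) then 0 else clipScale g (t + 2)) := by
    intro t _
    by_cases hs : IsSteady g (t + 1)
    · have ht : 1 ≤ t := by have := hs.1; omega
      have hR := rateDenominator_pos (v := v) hn h1 ht
      obtain ⟨e1, e2⟩ := hs.clippedGradient_eq h1
      rw [Nat.add_sub_cancel] at e2
      have hδ : ‖clippedGradient g (t + 1) i - clippedGradient g t i‖ ^ 2 ≤ steadyStepSq g v t := by
        rw [e1, e2, ← hv.sub_eq h1 hs i, steadyStepSq, if_pos hs]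
        exact Finset.single_le_sum (f := fun j => ‖v (t + 1) j - v t j‖ ^ 2)
          (fun _ _ => sq_nonneg _) (Finset.mem_univ i)
      rw [if_pos hs, mul_zero, add_zero, ← mul_div_assoc, mul_div_right_comm]
      exact mul_le_mul (effectiveRate_le_path ht) hδ (sq_nonneg _) (by positivity)
    -- In non-steady rounds the clipping part of the rate is used: `(4 B)² / (256 B) = B / 16`, and
    -- these scales sum to at most `6 U / 16`.
    · have hB := clipScale_pos g h1 (t + 1)
      have hd : ‖clippedGradient g (t + 1) i - clippedGradient g t i‖ ≤ 4 * clipScale g (t + 1) := by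
        have a1 := norm_clippedGradient_le_two_mul g h1 (t := t + 1) (by omega) i
        have a2 : ‖clippedGradient g t i‖ ≤ 2 * clipScale g (t + 1) := by
          rcases t with _ | t
          · rw [clippedGradient_zero g h0]; simpa using hB.le
          · have := clipScale_mono g (Nat.le_succ (t + 1))
            have := norm_clippedGradient_le_two_mul g h1 (t := t + 1) (by omega) i
            simp only [Nat.succ_eq_add_one] at *
            linarith
        linarith [norm_sub_le (clippedGradient g (t + 1) i) (clippedGradient g t i)]
      have hm1 : 1 ≤ √(Fintype.card (A i) : ℝ) := Real.one_le_sqrt.2 hm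
      rw [if_neg hs, steadyStepSq, if_neg hs, zero_div, mul_zero, zero_add]
      calc effectiveRate T g v i t * ‖clippedGradient g (t + 1) i - clippedGradient g t i‖ ^ 2
          ≤ 1 / (256 * √(Fintype.card (A i) : ℝ)) / clipScale g (t + 1)
            * (4 * clipScale g (t + 1)) ^ 2 := by
            apply mul_le_mul (effectiveRate_le_clip t)
              (pow_le_pow_left₀ (norm_nonneg _) hd 2) (sq_nonneg _) (by positivity)
        _ = 1 / 16 * clipScale g (t + 1) / √(Fintype.card (A i) : ℝ) := by field_simp; norm_num
        _ ≤ 1 / 16 * clipScale g (t + 1) := div_le_self (by positivity) hm1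
        _ ≤ 1 / 16 * clipScale g (t + 2) := by
            gcongr
            exact clipScale_mono g (by omega)
  refine (Finset.sum_le_sum hterm).trans ?_
  rw [Finset.sum_add_distrib, ← Finset.mul_sum, ← Finset.mul_sum]
  have b1 := sum_div_le_sqrt_sum (δ := steadyStepSq g v)
    (ρ := fun t => rateDenominator g v (t + 1)) N (fun t _ => steadyStepSq_nonneg g v t)
    (fun t _ ht => hv.sqrt_sum_le_rateDenominator h0 h1 ht)
  have b2 := sum_clipScale_not_steady_le g N
  have b3 := mul_le_mul_of_nonneg_left b1
    (by positivity : 0 ≤ Fintype.card (A i) * √(Real.log T))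
  linarith

end Rates

/-! ### Swap regret of one player -/

section SwapDecomposition

variable {α : Type*} [Fintype α]

/-- Stationarity rewrites the player's own payoff as the `p`-average of the payoffs of the rows of
`Q`, so the swap regret splits into regrets of the rows. -/
theorem IsStationary.dotProduct_swap {Q : α → α → ℝ} {p : α → ℝ} (hp : IsStationary Q p)
    (M : Matrix α α ℝ) (w : α → ℝ) :
    p ⬝ᵥ (M *ᵥ w - w) = ∑ a, (M a - Q a) ⬝ᵥ (p a • w) := by
  have h1 : p ⬝ᵥ w = ∑ a, p a * (Q a ⬝ᵥ w) := by
    simp only [dotProduct, Finset.mul_sum]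
    rw [Finset.sum_comm]
    refine Finset.sum_congr rfl fun k _ => ?_
    rw [← hp.2 k, Finset.sum_mul]
    exact Finset.sum_congr rfl fun a _ => by ring
  rw [dotProduct_sub, h1]
  simp only [dotProduct_smul, sub_dotProduct, smul_eq_mul, mul_sub, Finset.sum_sub_distrib]
  rfl

theorem abs_dotProduct_swap_le [DecidableEq α] {M : Matrix α α ℝ}
    (hM : M ∈ Matrix.rowStochastic ℝ α) {p : α → ℝ} (hp : p ∈ stdSimplex ℝ α) (w : α → ℝ) :
    |p ⬝ᵥ (M *ᵥ w - w)| ≤ 2 * ‖w‖ := by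
  have hrow : ∀ a, M a ∈ stdSimplex ℝ α := fun a =>
    ⟨fun k => (Matrix.mem_rowStochastic_iff_sum.1 hM).1 a k,
      (Matrix.mem_rowStochastic_iff_sum.1 hM).2 a⟩
  have h1 : ‖M *ᵥ w‖ ≤ ‖w‖ :=
    (pi_norm_le_iff_of_nonneg (norm_nonneg _)).2 fun a => abs_dotProduct_le_norm (hrow a)
  refine (abs_dotProduct_le_norm hp).trans ((norm_sub_le _ _).trans ?_)
  linarith

/-- The mixture of a row-stochastic matrix with the uniform distribution, of weight `1 / T`. -/
def mixUniform (M : Matrix α α ℝ) (T : ℕ) (a k : α) : ℝ :=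
  (1 - 1 / T) * M a k + 1 / T * (1 / Fintype.card α)

theorem uniform_mem_stdSimplex [Nonempty α] :
    (fun _ : α => 1 / (Fintype.card α : ℝ)) ∈ stdSimplex ℝ α :=
  ⟨fun _ => by positivity, by simp⟩

variable [DecidableEq α] {M : Matrix α α ℝ} {T : ℕ}

theorem mixUniform_le [Nonempty α] (hT : 1 ≤ T) (hM : M ∈ Matrix.rowStochastic ℝ α) (a k : α) :
    1 / (T * Fintype.card α) ≤ mixUniform M T a k := by
  have hT' : (1 : ℝ) ≤ T := by exact_mod_cast hT
  have h1 : 0 ≤ (1 - 1 / (T : ℝ)) * M a k :=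
    mul_nonneg (by rw [sub_nonneg]; exact (div_le_one (by linarith)).2 hT')
      ((Matrix.mem_rowStochastic_iff_sum.1 hM).1 a k)
  unfold mixUniform
  rw [one_div_mul_one_div]
  linarith

theorem mixUniform_isPositiveKernel [Nonempty α] (hT : 1 ≤ T)
    (hM : M ∈ Matrix.rowStochastic ℝ α) : IsPositiveKernel (mixUniform M T) := by
  have hm : (0 : ℝ) < Fintype.card α := by exact_mod_cast Fintype.card_pos
  have hT' : (0 : ℝ) < T := by exact_mod_cast hT
  have hpos : ∀ a k, 0 < mixUniform M T a k := fun a k =>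
    lt_of_lt_of_le (by positivity) (mixUniform_le hT hM a k)
  refine fun a => ⟨⟨fun k => (hpos a k).le, ?_⟩, hpos a⟩
  unfold mixUniform
  rw [Finset.sum_add_distrib, ← Finset.mul_sum, ← Finset.mul_sum,
    (Matrix.mem_rowStochastic_iff_sum.1 hM).2 a]
  simp

theorem logBarrier_mixUniform_le [Nonempty α] (hT : 1 ≤ T) (hM : M ∈ Matrix.rowStochastic ℝ α)
    (a : α) : logBarrier (mixUniform M T a) - Fintype.card α * Real.log (Fintype.card α)
      ≤ Fintype.card α * Real.log T := by
  have hm : (0 : ℝ) < Fintype.card α := by exact_mod_cast Fintype.card_pos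
  have hT' : (0 : ℝ) < T := by exact_mod_cast hT
  have h : ∑ _k : α, -(Real.log T + Real.log (Fintype.card α))
      ≤ ∑ k, Real.log (mixUniform M T a k) := by
    refine Finset.sum_le_sum fun k _ => ?_
    rw [← Real.log_mul hT'.ne' hm.ne', ← Real.log_inv, ← one_div]
    exact Real.log_le_log (by positivity) (mixUniform_le hT hM a k)
  rw [Finset.sum_const, Finset.card_univ, nsmul_eq_mul] at h
  unfold logBarrier
  linarith

theorem sum_sub_mixUniform_le [Nonempty α] (hM : M ∈ Matrix.rowStochastic ℝ α)
    {p : α → ℝ} (hp : p ∈ stdSimplex ℝ α) (w : α → ℝ) :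
    ∑ a, (M a - mixUniform M T a) ⬝ᵥ (p a • w) ≤ 1 / T * (2 * ‖w‖) := by
  have e : ∀ a, M a - mixUniform M T a
      = (1 / (T : ℝ)) • (M a - fun _ => 1 / (Fintype.card α : ℝ)) := by
    intro a
    funext k
    simp only [mixUniform, Pi.sub_apply, Pi.smul_apply, smul_eq_mul]
    ring
  have hterm : ∀ a, (M a - mixUniform M T a) ⬝ᵥ (p a • w) ≤ p a * (1 / T * (2 * ‖w‖)) := by
    intro a
    have hrow : M a ∈ stdSimplex ℝ α := ⟨fun k => (Matrix.mem_rowStochastic_iff_sum.1 hM).1 a k,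
      (Matrix.mem_rowStochastic_iff_sum.1 hM).2 a⟩
    have h1 := (abs_le.1 (abs_dotProduct_le_norm (w := w) hrow)).2
    have h2 := (abs_le.1 (abs_dotProduct_le_norm (w := w) (uniform_mem_stdSimplex (α := α)))).1
    rw [e, smul_dotProduct, dotProduct_smul, smul_eq_mul, smul_eq_mul, sub_dotProduct,
      mul_left_comm]
    have := hp.1 a
    gcongr
    linarith
  refine (Finset.sum_le_sum fun a _ => hterm a).trans_eq ?_
  rw [← Finset.sum_mul, hp.2, one_mul]

theorem swapRegretAgainst_one (x g : ℕ → α → ℝ) (T : ℕ) : swapRegretAgainst x g T 1 = 0 := by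
  simp [swapRegretAgainst]

end SwapDecomposition

/-! ### Runs of the algorithm: regret of one player and movement of the gradients -/

section Run

variable {n : ℕ} {A : Fin n → Type*} [∀ i, Fintype (A i)] [∀ i, DecidableEq (A i)]
  {u : Fin n → (∀ j, A j) → ℝ} {T : ℕ} {v x : ℕ → ∀ i, A i → ℝ} {y : ℕ → ∀ i, A i → A i → ℝ}

theorem IsRun.nonempty (hrun : IsRun u T v x y) (hT : 1 ≤ T) (i : Fin n) : Nonempty (A i) := by
  by_contra h
  rw [not_nonempty_iff] at h
  have := (hrun.strategy_mem 1 (by simp [hT]) i).2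
  simp at this

theorem gradient_zero : gradient u x 0 = 0 := by simp [gradient]

theorem gradient_of_pos {t : ℕ} (ht : 1 ≤ t) : gradient u x t = expectedUtility u (x t) :=
  if_neg (by omega)

theorem IsRun.norm_gradient_le (hrun : IsRun u T v x y) {U : ℝ} (hU : 0 ≤ U)
    (hu : ∀ i b, |u i b| ≤ U) {t : ℕ} (ht : t ∈ Finset.Icc 1 T) : ‖gradient u x t‖ ≤ U := by
  rw [gradient_of_pos (Finset.mem_Icc.1 ht).1]
  refine (pi_norm_le_iff_of_nonneg hU).2 fun i => (pi_norm_le_iff_of_nonneg hU).2 fun a => ?_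
  exact abs_expectedUtility_le hu (hrun.strategy_mem t ht) i a

theorem IsRun.norm_gradient_sub_le (hrun : IsRun u T v x y) {U : ℝ} (hU : 0 ≤ U)
    (hu : ∀ i b, |u i b| ≤ U) {t : ℕ} (ht : 1 ≤ t) (ht' : t + 1 ≤ T) (i : Fin n) :
    ‖gradient u x (t + 1) i - gradient u x t i‖
      ≤ U * ∑ j, ∑ k, |x (t + 1) j k - x t j k| := by
  rw [gradient_of_pos ht, gradient_of_pos (by omega)]
  refine (pi_norm_le_iff_of_nonneg (mul_nonneg hU (Finset.sum_nonneg fun _ _ =>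
    Finset.sum_nonneg fun _ _ => abs_nonneg _))).2 fun a => ?_
  exact abs_expectedUtility_sub_le hu (hrun.strategy_mem _ (by simp [ht']))
    (hrun.strategy_mem _ (by simp [ht]; omega)) i a

theorem IsRun.runningMax_le (hrun : IsRun u T v x y) {U : ℝ} (hU : 0 ≤ U)
    (hu : ∀ i b, |u i b| ≤ U) {t : ℕ} (ht : t ≤ T) : runningMax (gradient u x) t ≤ U := by
  refine SwapDynamics.runningMax_le _ hU fun s hs => hrun.norm_gradient_le hU hu ?_
  rw [Finset.mem_Icc] at hs ⊢
  omega

theorem IsRun.clipScale_le (hrun : IsRun u T v x y) {U : ℝ} (hU : 0 ≤ U)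
    (hu : ∀ i b, |u i b| ≤ U) (hT : 1 ≤ T) {t : ℕ} (ht : t ≤ T + 1) :
    clipScale (gradient u x) t ≤ U :=
  (clipScale_mono _ ht).trans ((clipScale_le_runningMax _ hT).trans (hrun.runningMax_le hU hu le_rfl))

theorem IsRun.sum_apply_eq (hrun : IsRun u T v x y) {t : ℕ} (ht : t ∈ Finset.Icc 1 T) (i : Fin n)
    (k : A i) : ∑ a, x t i a * y t i a k = x t i k := by
  have := congrFun (hrun.strategy_stationary t ht i) k
  rw [← this]
  simp [Matrix.mulVec, dotProduct, mul_comm]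

theorem IsRun.isBarrierMaximizer (hrun : IsRun u T v x y) (hn : 0 < n) (hT : 2 ≤ T)
    (h1 : gradient u x 1 ≠ 0) (i : Fin n) {t : ℕ} (ht : t + 1 ≤ T) (a : A i) :
    IsBarrierMaximizer (x t i a • clippedGradient (gradient u x) t i
      + ∑ s ∈ Finset.range t, x (s + 1) i a • clippedGradient (gradient u x) (s + 1) i)
      (effectiveRate T (gradient u x) v i t) (y (t + 1) i a) := by
  have hne := hrun.nonempty (by omega) i
  have hmem : t + 1 ∈ Finset.Icc 1 T := by simp [ht]
  rcases Nat.eq_zero_or_pos t with rfl | ht0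
  -- In the first round the prescribed uniform output is the barrier maximizer for zero gradients at
  -- any positive rate, so this round fits the FTRL scheme.
  · rw [clippedGradient_zero _ gradient_zero,
      hrun.expert_uniform _ hmem i a (Or.inl (rateDenominator_one _ _))]
    simpa using isBarrierMaximizer_uniform (effectiveRate_pos hT hn h1 0)
  · have h := hrun.expert_oftrl _ hmem i a (rateDenominator_pos hn h1 ht0).ne'
      (clipScale_pos _ h1 _).ne'
    have e : ∀ s, clippedExpertGradient (gradient u x) x i a s
        = x s i a • clippedGradient (gradient u x) s i := fun s => smul_comm _ _ _
    rw [Nat.add_sub_cancel] at h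
    simp only [e] at h
    have e2 : ∑ s ∈ Finset.Icc 1 t, x s i a • clippedGradient (gradient u x) s i
        = ∑ s ∈ Finset.range t, x (s + 1) i a • clippedGradient (gradient u x) (s + 1) i := by
      rw [Finset.range_eq_Ico, Finset.sum_Ico_add' (fun s => x s i a •
        clippedGradient (gradient u x) s i) 0 t 1]
      rfl
    rw [e2] at h
    unfold effectiveRate
    rwa [if_neg (by omega)]

theorem IsRun.isStationary (hrun : IsRun u T v x y) (i : Fin n) {t : ℕ} (ht : t + 1 ≤ T) :
    IsStationary (y (t + 1) i) (x (t + 1) i) :=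
  ⟨hrun.strategy_mem _ (by simp [ht]) i, hrun.sum_apply_eq (by simp [ht]) i⟩

/-- Swap regret of a player in terms of the path lengths and of the movement of the strategies. -/
theorem IsRun.swapRegretAgainst_le (hrun : IsRun u T v x y) (hn : 0 < n) {N : ℕ} (hN : 1 ≤ N)
    (hT : T = N + 1) (hv : IsRateSequence (gradient u x) v) (h1 : gradient u x 1 ≠ 0) {U : ℝ}
    (hU : 0 ≤ U) (hu : ∀ i b, |u i b| ≤ U) (i : Fin n) {M : Matrix (A i) (A i) ℝ}
    (hM : M ∈ Matrix.rowStochastic ℝ (A i)) :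
    swapRegretAgainst (fun t => x t i) (fun t => gradient u x t i) T M ≤
      13 * U + 256 * ((Fintype.card (A i) : ℝ) ^ 2 * √(Fintype.card (A i))) * Real.log T * U
        + Fintype.card (A i) * √(Real.log T) * (11 * √n * U
          + 33 * √(∑ t ∈ Finset.range N, steadyStepSq (gradient u x) v t))
        - ∑ t ∈ Finset.range N, (∑ a, |x (t + 2) i a - x (t + 1) i a|) ^ 2
          / (576 * Fintype.card (A i) * effectiveRate T (gradient u x) v i t) := by
  have hT2 : 2 ≤ T := by omega
  have hT1 : 1 ≤ T := by omega
  have hne := hrun.nonempty hT1 i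
  have hm : (0 : ℝ) < Fintype.card (A i) := by exact_mod_cast Fintype.card_pos
  have hL := log_pos_of_two_le hT2
  set g := gradient u x with hg
  have hg0 : g 0 = 0 := gradient_zero
  set h : ℕ → A i → ℝ := fun t => clippedGradient g t i with hh
  have hnorm : ∀ t ≤ N, ‖h (t + 1)‖ ≤ U := fun t ht =>
    (norm_clippedGradient_le g _ i).trans ((norm_le_pi_norm (g (t + 1)) i).trans
      (hrun.norm_gradient_le hU hu (by simp; omega)))
  have hst : ∀ t ≤ N, IsStationary (y (t + 1) i) (x (t + 1) i) := fun t ht =>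
    hrun.isStationary i (by omega)
  have hcT : clipScale g (T + 1) ≤ U := hrun.clipScale_le hU hu hT1 le_rfl
  have hcN : clipScale g (N + 1) ≤ U := hrun.clipScale_le hU hu hT1 (by omega)
  have hexp := experts_regret_bound (x := fun t => x t i) (h := h) (y := fun t => y t i)
    (η := effectiveRate T g v i) (c := mixUniform M T) (Λ := Real.log T) N
    (congrFun (clippedGradient_zero g hg0) i)
    (fun t _ => effectiveRate_pos hT2 hn h1 t) (fun t _ => effectiveRate_anti hn h1 t)
    (fun t ht a => hrun.isBarrierMaximizer hn hT2 h1 i (by omega) a) hst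
    (fun t _ => effectiveRate_mul_norm_le h1 t) (mixUniform_isPositiveKernel hT1 hM)
    (logBarrier_mixUniform_le hT1 hM)
  -- Replacing gradients by clipped ones costs a telescoping term.
  have hround : ∀ t ≤ N, x (t + 1) i ⬝ᵥ (M *ᵥ g (t + 1) i - g (t + 1) i) ≤
      x (t + 1) i ⬝ᵥ (M *ᵥ h (t + 1) - h (t + 1))
        + 4 * (clipScale g (t + 1 + 1) - clipScale g (t + 1)) := by
    intro t ht
    have e : M *ᵥ g (t + 1) i - g (t + 1) i = (M *ᵥ h (t + 1) - h (t + 1))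
        + (M *ᵥ (g (t + 1) i - h (t + 1)) - (g (t + 1) i - h (t + 1))) := by
      rw [Matrix.mulVec_sub]; abel
    rw [e, dotProduct_add]
    have a1 := (abs_le.1 (abs_dotProduct_swap_le hM (hst t ht).1 (g (t + 1) i - h (t + 1)))).2
    have a2 := norm_sub_clippedGradient_le g h1 (t := t + 1) (by omega) i
    simp only [hh] at a1 ⊢
    linarith
  have hsplit : ∀ t < N, x (t + 1) i ⬝ᵥ (M *ᵥ h (t + 1) - h (t + 1)) ≤
      ∑ a, (mixUniform M T a - y (t + 1) i a) ⬝ᵥ (x (t + 1) i a • h (t + 1)) + 1 / T * (2 * U) := by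
    intro t ht
    rw [(hst t ht.le).dotProduct_swap]
    have e : ∑ a, (M a - y (t + 1) i a) ⬝ᵥ (x (t + 1) i a • h (t + 1))
        = ∑ a, (mixUniform M T a - y (t + 1) i a) ⬝ᵥ (x (t + 1) i a • h (t + 1))
          + ∑ a, (M a - mixUniform M T a) ⬝ᵥ (x (t + 1) i a • h (t + 1)) := by
      rw [← Finset.sum_add_distrib]
      refine Finset.sum_congr rfl fun a _ => ?_
      rw [← add_dotProduct]
      congr 1
      abel
    rw [e]
    have a1 := sum_sub_mixUniform_le (T := T) hM (hst t ht.le).1 (h (t + 1))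
    have a2 : 1 / (T : ℝ) * (2 * ‖h (t + 1)‖) ≤ 1 / T * (2 * U) := by
      have := hnorm t ht.le
      gcongr
    linarith
  -- The FTRL bound covers `N = T - 1` rounds, its final iterate being the output of round `T`; the
  -- last round is bounded trivially.
  have hlast : x (N + 1) i ⬝ᵥ (M *ᵥ h (N + 1) - h (N + 1)) ≤ 2 * U := by
    have a1 := (abs_le.1 (abs_dotProduct_swap_le hM (hst N le_rfl).1 (h (N + 1)))).2
    have := hnorm N le_rfl
    linarith
  have hreg : swapRegretAgainst (fun t => x t i) (fun t => g t i) T M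
      = ∑ t ∈ Finset.range (N + 1), x (t + 1) i ⬝ᵥ (M *ᵥ g (t + 1) i - g (t + 1) i) := by
    unfold swapRegretAgainst
    rw [Finset.range_eq_Ico, Finset.sum_Ico_add' (fun s => x s i ⬝ᵥ (M *ᵥ g s i - g s i)) 0 (N + 1) 1,
      hT]
    rfl
  have hsum1 := Finset.sum_le_sum fun t (ht : t ∈ Finset.range (N + 1)) =>
    hround t (by have := Finset.mem_range.1 ht; omega)
  rw [Finset.sum_add_distrib, ← Finset.mul_sum,
    Finset.sum_range_sub (fun t => clipScale g (t + 1)), Finset.sum_range_succ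
      (fun t => x (t + 1) i ⬝ᵥ (M *ᵥ h (t + 1) - h (t + 1)))] at hsum1
  have hsum2 := Finset.sum_le_sum fun t (ht : t ∈ Finset.range N) =>
    hsplit t (Finset.mem_range.1 ht)
  rw [Finset.sum_add_distrib, Finset.sum_const, Finset.card_range, nsmul_eq_mul] at hsum2
  have hNT : (N : ℝ) * (1 / T * (2 * U)) ≤ 2 * U := by
    have hT0 : (0 : ℝ) < T := by exact_mod_cast hT1
    have h3 : (N : ℝ) / T ≤ 1 := (div_le_one hT0).2 (by exact_mod_cast (by omega : N ≤ T))
    calc (N : ℝ) * (1 / T * (2 * U)) = N / T * (2 * U) := by ring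
      _ ≤ 1 * (2 * U) := by gcongr
      _ = 2 * U := one_mul _
  have hB1 : 0 ≤ clipScale g (0 + 1) := clipScale_nonneg g _
  have hcT' : clipScale g (N + 1 + 1) ≤ U := by rw [hT] at hcT; exact hcT
  have hstabsum := hv.sum_effectiveRate_mul_le (T := T) (i := i) hg0 h1 hn hcN
  have hhN : ‖h N‖ ≤ U := by
    obtain ⟨k, rfl⟩ := Nat.exists_eq_add_of_le' hN
    exact hnorm k (by omega)
  have hrate : (Fintype.card (A i) : ℝ) ^ 2 * Real.log T / effectiveRate T g v i N ≤
      256 * ((Fintype.card (A i) : ℝ) ^ 2 * √(Fintype.card (A i))) * Real.log T * U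
        + Fintype.card (A i) * √(Real.log T) * (11 * √n * U
          + √(∑ t ∈ Finset.range N, steadyStepSq g v t)) := by
    have a1 := inv_effectiveRate_le (T := T) (v := v) (i := i) hT2 hn h1 hN
    have a2 := hv.rateDenominator_le hg0 h1 hcN (hrun.runningMax_le hU hu (by omega))
    have hsL : 0 < √(Real.log T) := Real.sqrt_pos.2 hL
    calc (Fintype.card (A i) : ℝ) ^ 2 * Real.log T / effectiveRate T g v i N
        = (Fintype.card (A i) : ℝ) ^ 2 * Real.log T * (1 / effectiveRate T g v i N) := by ring
      _ ≤ (Fintype.card (A i) : ℝ) ^ 2 * Real.log T *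
          (256 * √(Fintype.card (A i) : ℝ) * U + (11 * √n * U
          + √(∑ t ∈ Finset.range N, steadyStepSq g v t)) / (Fintype.card (A i) * √(Real.log T))) := by
          gcongr
          refine a1.trans ?_
          gcongr
      _ = _ := by
          have e : Real.log T = √(Real.log T) * √(Real.log T) := (Real.mul_self_sqrt hL.le).symm
          rw [mul_add]
          congr 1
          · ring
          · nth_rewrite 1 [e]
            field_simp
  -- The constant `13` collects `4` from clipping, `2` from mixing with the uniform distribution,
  -- `2` from the last round, `2` from the last prediction and `8 · 3/8` from non-steady stability
  -- terms; `33 = 1 + 8 · 4`.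
  rw [hreg]
  simp only [hh] at *
  linarith

/-- Movement of the gradients is controlled by the movement of the strategies. -/
theorem IsRun.steadyStepSq_le (hrun : IsRun u T v x y) (hv : IsRateSequence (gradient u x) v)
    (h1 : gradient u x 1 ≠ 0) {U : ℝ} (hU : 0 ≤ U) (hu : ∀ i b, |u i b| ≤ U) {t : ℕ}
    (ht : t + 2 ≤ T) : steadyStepSq (gradient u x) v (t + 1)
      ≤ n ^ 2 * U ^ 2 * ∑ i, (∑ a, |x (t + 2) i a - x (t + 1) i a|) ^ 2 := by
  unfold steadyStepSq
  split_ifs with hs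
  · have hterm : ∀ j, ‖v (t + 1 + 1) j - v (t + 1) j‖ ^ 2
        ≤ U ^ 2 * (n * ∑ i, (∑ a, |x (t + 2) i a - x (t + 1) i a|) ^ 2) := by
      intro j
      rw [hv.sub_eq h1 hs]
      refine (pow_le_pow_left₀ (norm_nonneg _)
        (hrun.norm_gradient_sub_le hU hu (by omega) ht j) 2).trans ?_
      rw [mul_pow]
      -- One factor `n` comes from Cauchy–Schwarz over the players who move, the other from summing
      -- over the players whose gradients move.
      have := sq_sum_le_card_mul_sum_sq (s := Finset.univ)
        (f := fun i => ∑ a, |x (t + 2) i a - x (t + 1) i a|)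
      rw [Finset.card_univ, Fintype.card_fin] at this
      gcongr
    refine (Finset.sum_le_sum fun j _ => hterm j).trans_eq ?_
    rw [Finset.sum_const, Finset.card_univ, Fintype.card_fin, nsmul_eq_mul]
    ring
  · exact mul_nonneg (by positivity) (Finset.sum_nonneg fun _ _ => sq_nonneg _)

end Run

/-! ### The main theorem -/

/-- If `W > 300 P`, then `W³` exceeds `90000 P² W`, and the excess over `57024 P² W` is already
larger than `518400 P³`. -/
theorem le_of_pow_three_le {P W : ℝ} (hP : 0 ≤ P) (h : W ^ 3 ≤ 518400 * P ^ 3 + 57024 * P ^ 2 * W) :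
    W ≤ 300 * P := by
  by_contra! hlt
  have hW : 0 < W := by linarith
  have h2 : 90000 * P ^ 2 ≤ W ^ 2 := by nlinarith
  have h3 : 0 ≤ W * (W ^ 2 - 90000 * P ^ 2) := mul_nonneg hW.le (by linarith)
  rcases hP.eq_or_lt with h0 | h0
  · rw [← h0] at h
    have : 0 < W ^ 3 := by positivity
    norm_num at h
    linarith
  · have h4 : 300 * P * P ^ 2 ≤ W * P ^ 2 := by gcongr
    have : 0 < P ^ 3 := by positivity
    nlinarith

/-- The arithmetic that turns the self-bounding inequality for the path length `W` into the final
bound; `q`, `r`, `s` are the square roots of the number of players, the number of actions and the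
logarithm of the horizon. -/
theorem self_bounding {q r s U W Z : ℝ} (hq : 1 ≤ q) (hr : 1 ≤ r) (hs : 4 / 5 ≤ s) (hU : 0 ≤ U)
    (hZ : Z = 13 * U + 256 * ((r ^ 2) ^ 2 * r) * s ^ 2 * U + r ^ 2 * s * (11 * q * U + 33 * W))
    (hW : W ^ 3 ≤ 3 * ((q ^ 2) ^ 2 * U ^ 2) * (576 * (r ^ 2) ^ 2 * s * (q ^ 2 * Z))) :
    Z ≤ 10200 * U * (q ^ 2 * q) * ((r ^ 2) ^ 2 * r) * s ^ 2 := by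
  have hs0 : 0 < s := by linarith
  have hss : 1 ≤ 5 / 4 * s := by linarith
  have hs2 : 1 ≤ 2 * s ^ 2 := by nlinarith
  have hr5 : 1 ≤ r ^ 5 := one_le_pow₀ hr
  have hr35 : r ^ 2 ≤ r ^ 5 := pow_le_pow_right₀ hr (by norm_num)
  have a1 : 13 * U ≤ 26 * (q * r ^ 5 * s ^ 2 * U) := by
    have h1 : 1 ≤ q * r ^ 5 := one_le_mul_of_one_le_of_one_le hq hr5
    have h2 : 1 ≤ q * r ^ 5 * (2 * s ^ 2) := one_le_mul_of_one_le_of_one_le h1 hs2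
    have := mul_le_mul_of_nonneg_right h2 hU
    linarith
  have a2 : 256 * ((r ^ 2) ^ 2 * r) * s ^ 2 * U ≤ 256 * (q * r ^ 5 * s ^ 2 * U) := by
    have h1 : 0 ≤ r ^ 5 * s ^ 2 * U := by positivity
    have := mul_le_mul_of_nonneg_right hq h1
    linarith
  have a3 : r ^ 2 * s * (11 * q * U) ≤ 14 * (q * r ^ 5 * s ^ 2 * U) := by
    have h1 : r ^ 2 * s ≤ r ^ 5 * s * (5 / 4 * s) := by
      calc r ^ 2 * s ≤ r ^ 5 * s * 1 := by rw [mul_one]; gcongr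
        _ ≤ r ^ 5 * s * (5 / 4 * s) := by gcongr
    have h2 : 0 ≤ 11 * q * U := by positivity
    have h3 := mul_le_mul_of_nonneg_right h1 h2
    have h4 : 0 ≤ q * r ^ 5 * s ^ 2 * U := by positivity
    linarith
  -- Here `26 + 256 + 14 ≤ 300`. Then `518400 = 3 · 576 · 300` and `57024 = 3 · 576 · 33` below, and
  -- `10200 = 300 + 33 · 300` at the end.
  have hX : Z ≤ 300 * (q * r ^ 5 * s ^ 2 * U) + 33 * (r ^ 2 * s * W) := by
    have h4 : 0 ≤ q * r ^ 5 * s ^ 2 * U := by positivity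
    rw [hZ, mul_add]
    linarith
  set P : ℝ := q ^ 3 * r ^ 3 * s * U with hP
  have hP0 : 0 ≤ P := by positivity
  have hWP : W ≤ 300 * P := by
    refine le_of_pow_three_le hP0 (hW.trans ?_)
    calc 3 * ((q ^ 2) ^ 2 * U ^ 2) * (576 * (r ^ 2) ^ 2 * s * (q ^ 2 * Z))
        ≤ 3 * ((q ^ 2) ^ 2 * U ^ 2) * (576 * (r ^ 2) ^ 2 * s *
          (q ^ 2 * (300 * (q * r ^ 5 * s ^ 2 * U) + 33 * (r ^ 2 * s * W)))) := by gcongr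
      _ = 518400 * (q ^ 7 * (r ^ 9 * s ^ 3 * U ^ 3)) + 57024 * P ^ 2 * W := by rw [hP]; ring
      _ ≤ 518400 * (q ^ 9 * (r ^ 9 * s ^ 3 * U ^ 3)) + 57024 * P ^ 2 * W := by
          gcongr
          norm_num
      _ = 518400 * P ^ 3 + 57024 * P ^ 2 * W := by rw [hP]; ring
  have b1 : r ^ 2 * s * W ≤ 300 * (q ^ 3 * r ^ 5 * s ^ 2 * U) := by
    calc r ^ 2 * s * W ≤ r ^ 2 * s * (300 * P) := by gcongr
      _ = _ := by rw [hP]; ring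
  have b2 : q * r ^ 5 * s ^ 2 * U ≤ q ^ 3 * r ^ 5 * s ^ 2 * U := by
    gcongr
    exact le_self_pow₀ hq (by norm_num)
  calc Z ≤ 10200 * (q ^ 3 * r ^ 5 * s ^ 2 * U) := by linarith
    _ = _ := by ring

section Run

variable {n : ℕ} {A : Fin n → Type*} [∀ i, Fintype (A i)] [∀ i, DecidableEq (A i)]
  {u : Fin n → (∀ j, A j) → ℝ} {T : ℕ} {v x : ℕ → ∀ i, A i → ℝ} {y : ℕ → ∀ i, A i → A i → ℝ}

omit [∀ i, DecidableEq (A i)] in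
theorem card_le_maxActions (i : Fin n) : Fintype.card (A i) ≤ maxActions A :=
  Finset.le_sup (f := fun i => Fintype.card (A i)) (Finset.mem_univ i)

/-- The movement of the strategies, weighted with the denominators of the learning rates. -/
def weightedMovement (g v x : ℕ → ∀ i, A i → ℝ) (N : ℕ) (i : Fin n) : ℝ :=
  ∑ t ∈ Finset.range N, rateDenominator g v (t + 1) * (∑ a, |x (t + 2) i a - x (t + 1) i a|) ^ 2

omit [∀ i, DecidableEq (A i)] in
theorem weightedMovement_nonneg (g v x : ℕ → ∀ i, A i → ℝ) (N : ℕ) (i : Fin n) :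
    0 ≤ weightedMovement g v x N i :=
  Finset.sum_nonneg fun _ _ => mul_nonneg (Real.sqrt_nonneg _) (sq_nonneg _)

/-- The swap regret of each player, with constants that do not depend on the player. -/
theorem IsRun.swapRegretAgainst_le_maxActions (hrun : IsRun u T v x y) (hn : 0 < n) {N : ℕ}
    (hN : 1 ≤ N) (hT : T = N + 1) (hv : IsRateSequence (gradient u x) v)
    (h1 : gradient u x 1 ≠ 0) {U : ℝ} (hU : 0 ≤ U) (hu : ∀ i b, |u i b| ≤ U) (i : Fin n)
    {M : Matrix (A i) (A i) ℝ} (hM : M ∈ Matrix.rowStochastic ℝ (A i)) :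
    swapRegretAgainst (fun t => x t i) (fun t => gradient u x t i) T M ≤
      13 * U + 256 * ((maxActions A : ℝ) ^ 2 * √(maxActions A)) * Real.log T * U
        + maxActions A * √(Real.log T) * (11 * √n * U
          + 33 * √(∑ t ∈ Finset.range N, steadyStepSq (gradient u x) v t))
        - weightedMovement (gradient u x) v x N i
          / (576 * (maxActions A : ℝ) ^ 2 * √(Real.log T)) := by
  have hT2 : 2 ≤ T := by omega
  have hne := hrun.nonempty (by omega) i
  have hm : (0 : ℝ) < Fintype.card (A i) := by exact_mod_cast Fintype.card_pos
  have hmm : (Fintype.card (A i) : ℝ) ≤ maxActions A := by exact_mod_cast card_le_maxActions i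
  have hL := log_pos_of_two_le hT2
  have hsL : 0 < √(Real.log T) := Real.sqrt_pos.2 hL
  refine (hrun.swapRegretAgainst_le hn hN hT hv h1 hU hu i hM).trans ?_
  have hmove : weightedMovement (gradient u x) v x N i
        / (576 * (maxActions A : ℝ) ^ 2 * √(Real.log T)) ≤
      ∑ t ∈ Finset.range N, (∑ a, |x (t + 2) i a - x (t + 1) i a|) ^ 2
          / (576 * Fintype.card (A i) * effectiveRate T (gradient u x) v i t) := by
    unfold weightedMovement
    rw [Finset.sum_div]
    refine Finset.sum_le_sum fun t _ => ?_
    have hη := effectiveRate_pos (v := v) (i := i) hT2 hn h1 t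
    have hR := rateDenominator_le_inv_effectiveRate (v := v) (i := i) hT2 hn h1 t
    set e := (∑ a, |x (t + 2) i a - x (t + 1) i a|) ^ 2
    have he : 0 ≤ e := sq_nonneg _
    calc rateDenominator (gradient u x) v (t + 1) * e
          / (576 * (maxActions A : ℝ) ^ 2 * √(Real.log T))
        ≤ Fintype.card (A i) * √(Real.log T) / effectiveRate T (gradient u x) v i t * e
          / (576 * (Fintype.card (A i) : ℝ) ^ 2 * √(Real.log T)) := by gcongr
      _ = e / (576 * Fintype.card (A i) * effectiveRate T (gradient u x) v i t) := by field_simp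
  have hb1 : 256 * ((Fintype.card (A i) : ℝ) ^ 2 * √(Fintype.card (A i))) * Real.log T * U
      ≤ 256 * ((maxActions A : ℝ) ^ 2 * √(maxActions A)) * Real.log T * U := by gcongr
  have hb2 : Fintype.card (A i) * √(Real.log T) * (11 * √n * U
          + 33 * √(∑ t ∈ Finset.range N, steadyStepSq (gradient u x) v t))
      ≤ maxActions A * √(Real.log T) * (11 * √n * U
          + 33 * √(∑ t ∈ Finset.range N, steadyStepSq (gradient u x) v t)) := by gcongr
  linarith

/-- The path length is controlled by the weighted movement of the strategies. -/
theorem IsRun.sqrt_sum_pow_three_le (hrun : IsRun u T v x y) {N : ℕ}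
    (hT : T = N + 1) (hv : IsRateSequence (gradient u x) v)
    (h1 : gradient u x 1 ≠ 0) {U : ℝ} (hU : 0 ≤ U) (hu : ∀ i b, |u i b| ≤ U) :
    √(∑ t ∈ Finset.range N, steadyStepSq (gradient u x) v t) ^ 3
      ≤ 3 * ((n : ℝ) ^ 2 * U ^ 2) * ∑ i, weightedMovement (gradient u x) v x N i := by
  refine (SwapDynamics.sqrt_sum_pow_three_le N (fun t _ => steadyStepSq_nonneg _ v t)
    (fun t _ ht => hv.sqrt_sum_le_rateDenominator_prev gradient_zero h1 ht)).trans ?_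
  rw [mul_assoc]
  refine mul_le_mul_of_nonneg_left ?_ (by norm_num)
  unfold weightedMovement
  rw [Finset.sum_comm, Finset.mul_sum]
  rcases N with _ | N
  · simp
  have hR : ∀ t, 0 ≤ rateDenominator (gradient u x) v t := fun t => Real.sqrt_nonneg _
  have hzero : steadyStepSq (gradient u x) v 0 = 0 :=
    if_neg fun h => absurd h.1 (by norm_num)
  -- Step `t + 1` of the gradients is matched with movement `t` of the strategies. The unmatched
  -- terms are the first step, which is not steady, and a nonnegative last movement.
  rw [Finset.sum_range_succ', Finset.sum_range_succ, hzero, mul_zero]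
  refine add_le_add (Finset.sum_le_sum fun t ht => ?_) ?_
  · have := hrun.steadyStepSq_le hv h1 hU hu (t := t) (by have := Finset.mem_range.1 ht; omega)
    rw [← Finset.mul_sum, mul_left_comm]
    exact mul_le_mul_of_nonneg_left this (hR _)
  · exact mul_nonneg (by positivity)
      (Finset.sum_nonneg fun _ _ => mul_nonneg (hR _) (sq_nonneg _))

/-- The swap regret bound when the first gradients do not all vanish. -/
theorem IsRun.swapRegretAgainst_le_final (hrun : IsRun u T v x y) (hn : 0 < n) (hT : 2 ≤ T)
    (hv : IsRateSequence (gradient u x) v) (h1 : gradient u x 1 ≠ 0) {U : ℝ} (hU : 0 ≤ U)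
    (hu : ∀ i b, |u i b| ≤ U) (i : Fin n) {M : Matrix (A i) (A i) ℝ}
    (hM : M ∈ Matrix.rowStochastic ℝ (A i)) :
    swapRegretAgainst (fun t => x t i) (fun t => gradient u x t i) T M ≤
      10200 * U * (n * √n) * ((maxActions A : ℝ) ^ 2 * √(maxActions A)) * Real.log T := by
  obtain ⟨N, rfl⟩ : ∃ N, T = N + 1 := ⟨T - 1, by omega⟩
  have hN : 1 ≤ N := by omega
  have hne := hrun.nonempty (by omega) i
  have hm1 : (1 : ℝ) ≤ maxActions A := by
    have : 0 < Fintype.card (A i) := Fintype.card_pos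
    exact_mod_cast this.trans_le (card_le_maxActions i)
  have hn1 : (1 : ℝ) ≤ n := by exact_mod_cast hn
  have hL := log_pos_of_two_le hT
  -- `log 2 > 0.69 > (4/5)²`.
  have hs : 4 / 5 ≤ √(Real.log (N + 1 : ℕ)) := by
    apply Real.le_sqrt_of_sq_le
    have h2 : Real.log 2 ≤ Real.log (N + 1 : ℕ) :=
      Real.log_le_log (by norm_num) (by exact_mod_cast hT)
    have := Real.log_two_gt_d9
    linarith
  set g := gradient u x with hg
  set s := √(Real.log (N + 1 : ℕ)) with hsdef
  set q := √(n : ℝ) with hqdef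
  set r := √(maxActions A : ℝ) with hrdef
  set W := √(∑ t ∈ Finset.range N, steadyStepSq g v t) with hWdef
  have hs2 : Real.log (N + 1 : ℕ) = s ^ 2 := (Real.sq_sqrt hL.le).symm
  have hq2 : (n : ℝ) = q ^ 2 := (Real.sq_sqrt (by linarith)).symm
  have hr2 : (maxActions A : ℝ) = r ^ 2 := (Real.sq_sqrt (by linarith)).symm
  have hplayer := fun (j : Fin n) (K : Matrix (A j) (A j) ℝ)
    (hK : K ∈ Matrix.rowStochastic ℝ (A j)) =>
      hrun.swapRegretAgainst_le_maxActions hn hN rfl hv h1 hU hu j hK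
  rw [← hg, ← hsdef, ← hqdef, ← hrdef, ← hWdef, hs2, hr2] at hplayer
  obtain ⟨Z, hZ⟩ : ∃ Z, Z = 13 * U + 256 * ((r ^ 2) ^ 2 * r) * s ^ 2 * U
    + r ^ 2 * s * (11 * q * U + 33 * W) := ⟨_, rfl⟩
  rw [← hZ] at hplayer
  have hs0 : 0 < s := by linarith
  have hq1 : 1 ≤ q := Real.one_le_sqrt.2 hn1
  have hr1 : 1 ≤ r := Real.one_le_sqrt.2 hm1
  have hmove : ∑ j, weightedMovement g v x N j ≤ 576 * (r ^ 2) ^ 2 * s * (q ^ 2 * Z) := by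
    have hterm : ∀ j ∈ Finset.univ, weightedMovement g v x N j ≤ 576 * (r ^ 2) ^ 2 * s * Z := by
      intro j _
      -- The identity matrix has zero regret, so the upper bound is nonnegative and limits the
      -- movement of every player.
      have h := hplayer j 1 (one_mem _)
      rw [swapRegretAgainst_one] at h
      have h2 : weightedMovement g v x N j / (576 * (r ^ 2) ^ 2 * s) ≤ Z := by linarith
      rw [div_le_iff₀ (by positivity)] at h2
      linarith
    refine (Finset.sum_le_sum hterm).trans_eq ?_
    rw [Finset.sum_const, Finset.card_univ, Fintype.card_fin, nsmul_eq_mul, hq2]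
    ring
  have hW3 := hrun.sqrt_sum_pow_three_le rfl hv h1 hU hu
  rw [← hg, ← hWdef, hq2] at hW3
  have hfinal := self_bounding hq1 hr1 hs hU hZ
    (hW3.trans (mul_le_mul_of_nonneg_left hmove (by positivity)))
  have hpos : 0 ≤ weightedMovement g v x N i / (576 * (r ^ 2) ^ 2 * s) :=
    div_nonneg (weightedMovement_nonneg g v x N i) (by positivity)
  rw [hs2, hq2, hr2]
  linarith [hplayer i M hM]

/-- If the first gradients vanish then all strategies are uniform and all gradients vanish. -/
theorem IsRun.gradient_eq_zero (hrun : IsRun u T v x y) (h1 : gradient u x 1 = 0) {t : ℕ}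
    (ht : t ∈ Finset.Icc 1 T) : gradient u x t = 0 := by
  have hx : ∀ s ∈ Finset.Icc 1 T, x s = fun i _ => 1 / (Fintype.card (A i) : ℝ) := by
    intro s hs
    funext i k
    rw [← hrun.sum_apply_eq hs i k]
    simp only [hrun.expert_uniform s hs i _ (Or.inr (clipScale_eq_zero _ h1 s))]
    rw [← Finset.sum_mul, (hrun.strategy_mem s hs i).2, one_mul]
  have hmem := Finset.mem_Icc.1 ht
  have h1T : 1 ∈ Finset.Icc 1 T := by simp; omega
  rw [gradient_of_pos le_rfl, hx 1 h1T] at h1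
  rw [gradient_of_pos hmem.1, hx t ht, h1]

end Run

end SwapDynamics

end

theorem mainTheorem2 :
    ∃ C : ℝ, 0 < C ∧
      ∀ (n : ℕ), 2 ≤ n →
      ∀ (A : Fin n → Type*) [∀ i, Fintype (A i)] [∀ i, DecidableEq (A i)]
        (u : Fin n → (∀ j, A j) → ℝ) (Umax : ℝ), (∀ i b, |u i b| ≤ Umax) →
      ∀ (T : ℕ), 2 ≤ T →
      ∀ (x : ℕ → ∀ i, A i → ℝ) (y : ℕ → ∀ i, A i → A i → ℝ) (v : ℕ → ∀ i, A i → ℝ),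
        (v = SwapDynamics.clippedGradient (SwapDynamics.gradient u x) ∨
          v = SwapDynamics.gradient u x) →
        SwapDynamics.IsRun u T v x y →
        (∀ i, SwapDynamics.swapRegret (fun t => x t i) (fun t => SwapDynamics.gradient u x t i) T
            ≤ C * Umax * (n : ℝ) ^ (3 / 2 : ℝ) * (SwapDynamics.maxActions A : ℝ) ^ (5 / 2 : ℝ)
              * Real.log T) ∧
        SwapDynamics.IsApproxCorrelatedEquilibrium u
          (C * Umax * (n : ℝ) ^ (3 / 2 : ℝ) * (SwapDynamics.maxActions A : ℝ) ^ (5 / 2 : ℝ)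
            * Real.log T / T)
          (SwapDynamics.averagePlay x T) := by
  refine ⟨10200, by norm_num, ?_⟩
  intro n hn A _ _ u U hu T hT x y v hv hrun
  have hne : ∀ i, Nonempty (A i) := hrun.nonempty (by omega)
  -- Nonnegativity of `U` follows from the existence of an action profile, since the simplices
  -- containing the strategies are nonempty.
  have hU : 0 ≤ U := (abs_nonneg _).trans (hu ⟨0, by omega⟩ fun i => Classical.arbitrary (A i))
  have hL := SwapDynamics.log_pos_of_two_le hT
  have hm0 : (0 : ℝ) ≤ SwapDynamics.maxActions A := Nat.cast_nonneg _
  have hn0 : (0 : ℝ) ≤ n := Nat.cast_nonneg _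
  have e1 : (n : ℝ) ^ (3 / 2 : ℝ) = n * √n := by
    rw [Real.sqrt_eq_rpow, show (3 / 2 : ℝ) = 1 + 1 / 2 by norm_num,
      Real.rpow_add' hn0 (by norm_num), Real.rpow_one]
  have e2 : (SwapDynamics.maxActions A : ℝ) ^ (5 / 2 : ℝ)
      = (SwapDynamics.maxActions A : ℝ) ^ 2 * √(SwapDynamics.maxActions A) := by
    rw [Real.sqrt_eq_rpow, show (5 / 2 : ℝ) = 2 + 1 / 2 by norm_num,
      Real.rpow_add' hm0 (by norm_num), Real.rpow_two]
  have hreg : ∀ i, SwapDynamics.swapRegret (fun t => x t i)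
      (fun t => SwapDynamics.gradient u x t i) T ≤ 10200 * U * (n : ℝ) ^ (3 / 2 : ℝ)
        * (SwapDynamics.maxActions A : ℝ) ^ (5 / 2 : ℝ) * Real.log T := by
    intro i
    rw [e1, e2]
    obtain ⟨M, hM, hMeq⟩ := (SwapDynamics.swapRegret_isGreatest (fun t => x t i)
      (fun t => SwapDynamics.gradient u x t i) T).1
    rw [← hMeq]
    by_cases h1 : SwapDynamics.gradient u x 1 = 0
    · have : SwapDynamics.swapRegretAgainst (fun t => x t i)
          (fun t => SwapDynamics.gradient u x t i) T M = 0 :=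
        Finset.sum_eq_zero fun t ht => by simp [hrun.gradient_eq_zero h1 ht]
      rw [this]
      positivity
    · exact hrun.swapRegretAgainst_le_final (by omega) hT hv h1 hU hu i hM
  exact ⟨hreg, SwapDynamics.isApproxCorrelatedEquilibrium_averagePlay u (by omega)
    hrun.strategy_mem hreg⟩
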